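/- Let $n\ge 1$ and $k\ge 0$ be integers. **Partitions and weights.** Let $\mathcal P_{\le n-1,k}$ be the set of partitions $\lambda=(\lambda_1\ge\dots\ge\lambda_{n-1}\ge 0)$ with $\lambda_1\le k$; put $\lambda_n=0$, $|\lambda|=\sum_i\lambda_i$, and let $\lambda^t$ be the transposed partition. Let $P_k^+$ be the set of $n$-tuples $m=(m_1,\dots,m_n)$ of non-negative integers with $\sum_i m_i=k$ (the dominant integral weights of $\widehat{\mathfrak{su}}(n)$ of level $k$), and for $\lambda\in\mathcal P_{\le n-1,k}$ let $\hat\lambda\in P_k^+$ be given by $m_i=\lambda_i-\lambda_{i+1}$ for $1\le i\le n-1$ and $m_n=k-\lambda_1$ (for $n=1$: $m_1=k$). **Affine plactic Schur polynomials (at $z=1$).** On the complex vector space with basis $\mathbb Z_{\ge0}^n$ let $\varphi_i^*m=(m_1,\dots,m_i+1,\dots,m_n)$, and $\varphi_i m=(m_1,\dots,m_i-1,\dots,m_n)$ if $m_i>0$, $\varphi_i m=0$ otherwise. Put $a_j=\varphi_{j+1}^*\varphi_j$ for $1\le j\le n-1$, $$h_r(a)=\sum_{\varepsilon_0+\dots+\varepsilon_{n-1}=r}(\varphi_1^*)^{\varepsilon_0}a_1^{\varepsilon_1}\cdots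 a_{n-1}^{\varepsilon_{n-1}}\varphi_n^{\varepsilon_0}\quad(r\ge0),\qquad h_r(a)=0\quad(r<0),$$ and $s_\lambda(a)=\det\big(h_{\lambda_i-i+j}(a)\big)_{1\le i,j\le n-1}$, where in each term of the Leibniz expansion the factors are multiplied in the order of the rows. These operators preserve the span $\mathbb CP_k^+$ of $P_k^+$; let $s_\lambda(a)_k$ be the restriction of $s_\lambda(a)$ to $\mathbb CP_k^+$, and let $\mathcal F'_{n,k}\subset\mathrm{End}(\mathbb CP_k^+)$ be the (unital) $\mathbb C$-subalgebra generated by all $s_\lambda(a)_k$, $\lambda\in\mathcal P_{\le n-1,k}$. **Bethe variety.** In $\mathbb C[e_1,\dots,e_k]$ put $e_0=1$, $e_r=0$ for $r<0$ or $r>k$, and $h_r=\det(e_{1-i+j})_{1\le i,j\le r}$. Let $\mathbb V_{n,k}\subset\mathbb C^k$ be the common zero set of the $k$ polynomials $h_n-1,h_{n+1},\dots,h_{n+k-1}$, and $\mathcal I(\mathbb V_{n,k})\subset\mathbb C[e_1,\dots,e_k]$ the ideal of all polynomials vanishing on $\mathbb V_{n,k}$. Identify $\mathbb C[e_1,\dots,e_k]$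 with $\mathbb C[x_1,\dots,x_k]^{S_k}$, $e_r$ being the $r$-th elementary symmetric polynomial; for $\lambda\in\mathcal P_{\le n-1,k}$ let $[s_{\lambda^t}]$ be the class modulo $\mathcal I(\mathbb V_{n,k})$ of the Schur polynomial $s_{\lambda^t}(x_1,\dots,x_k)=\sum_T x^T$, the sum over semistandard tableaux $T$ of shape $\lambda^t$ with entries in $\{1,\dots,k\}$. **Fusion coefficients.** Let $(\sigma+\rho)_i=\sigma_i-\frac{|\sigma|}n+\frac{n+1}2-i$ for $1\le i\le n$, and $$S_{\hat\lambda\hat\sigma}=\frac{e^{i\pi n(n-1)/4}}{\sqrt{n(k+n)^{n-1}}}\sum_{w\in S_n}\operatorname{sgn}(w)\,e^{-\frac{2\pi i}{k+n}(\sigma+\rho,\,w(\lambda+\rho))},\qquad \mathcal N^{(k),\hat\nu}_{\hat\lambda\hat\mu}=\sum_{\sigma\in\mathcal P_{\le n-1,k}}\frac{S_{\hat\lambda\hat\sigma}S_{\hat\mu\hat\sigma}(S^{-1})_{\hat\nu\hat\sigma}}{S_{\hat\emptyset\hat\sigma}},$$ with $(\cdot,\cdot)$ the standard inner product of $\mathbb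 R^n$ and $S_n$ permuting coordinates. **Claim.** (1) There is an isomorphism of $\mathbb C$-algebras $\mathcal F'_{n,k}\cong\mathbb C[e_1,\dots,e_k]/\mathcal I(\mathbb V_{n,k})$ with $s_\lambda(a)_k\mapsto[s_{\lambda^t}]$ for all $\lambda\in\mathcal P_{\le n-1,k}$. (2) For all $\lambda,\mu\in\mathcal P_{\le n-1,k}$, $$s_\lambda(a)_k\,s_\mu(a)_k=\sum_{\nu\in\mathcal P_{\le n-1,k}}\mathcal N^{(k),\hat\nu}_{\hat\lambda\hat\mu}\,s_\nu(a)_k .$$ (3) The operators $s_\lambda(a)_k$ are the fusion matrices: for all $\lambda,\mu\in\mathcal P_{\le n-1,k}$, $$s_\lambda(a)_k\,\hat\mu=\sum_{\nu\in\mathcal P_{\le n-1,k}}\mathcal N^{(k),\hat\nu}_{\hat\lambda\hat\mu}\,\hat\nu .$$ -/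

import Mathlib

/-!
Throughout, `N` is the rank and `n = N + 1`, so that the algebra in question is the affine
`su(N + 1)`. Sites `1, ..., n` of the affine Dynkin diagram are `0, ..., N` in `Fin (N + 1)`;
the site `n` (the affine node) is `Fin.last N`. The quasi-periodicity parameter is `z = 1`.
-/

noncomputable section

namespace PhaseModel

/-! ### The state space and the phase algebra -/

/-- The space `ℂP⁺` spanned by all `n`-tuples of Dynkin labels `(m₁, ..., mₙ)`. -/
abbrev State (N : ℕ) : Type := (Fin (N + 1) → ℕ) →₀ ℂ

/-- The subspace `ℂP⁺ₖ` spanned by the tuples with `m₁ + ... + mₙ = k`. -/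
def level (N k : ℕ) : Submodule ℂ (State N) :=
  Finsupp.supported ℂ ℂ {m | ∑ i, m i = k}

/-- `φᵢ* (m₁, ..., mₙ) = (m₁, ..., mᵢ + 1, ..., mₙ)`. -/
def phiStar {N : ℕ} (i : Fin (N + 1)) : Module.End ℂ (State N) :=
  Finsupp.linearCombination ℂ fun m => Finsupp.single (Function.update m i (m i + 1)) 1

/-- `φᵢ (m₁, ..., mₙ) = (m₁, ..., mᵢ - 1, ..., mₙ)` if `mᵢ > 0`, and `0` otherwise. -/
def phi {N : ℕ} (i : Fin (N + 1)) : Module.End ℂ (State N) :=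
  Finsupp.linearCombination ℂ fun m =>
    if 0 < m i then Finsupp.single (Function.update m i (m i - 1)) 1 else 0

/-- The finite plactic generators `aⱼ = φⱼ₊₁* φⱼ`, `1 ≤ j ≤ n - 1`. -/
def plactic {N : ℕ} (j : Fin N) : Module.End ℂ (State N) :=
  phiStar j.succ * phi j.castSucc

/-! ### Affine plactic polynomials -/

/-- The affine plactic complete symmetric polynomial (at `z = 1`): the sum over all compositions
`ε = (ε₀, ..., εₙ₋₁)` of `r` of `(φ₁*)^ε₀ a₁^ε₁ ⋯ aₙ₋₁^εₙ₋₁ φₙ^ε₀`. -/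
def placticH (N r : ℕ) : Module.End ℂ (State N) :=
  ∑ ε ∈ Finset.piAntidiag (Finset.univ : Finset (Fin (N + 1))) r,
    phiStar 0 ^ ε 0 * (List.ofFn fun j : Fin N => plactic j ^ ε j.succ).prod *
      phi (Fin.last N) ^ ε 0

/-- `hᵣ` for an integer index, with `hᵣ = 0` for `r < 0`. -/
def placticHInt (N : ℕ) (r : ℤ) : Module.End ℂ (State N) :=
  if 0 ≤ r then placticH N r.toNat else 0

/-- Partitions whose Young diagram fits into the box of height `N = n - 1` and width `k`. -/
abbrev BoxPartition (N k : ℕ) : Type := {lam : Fin N → Fin (k + 1) // Antitone lam}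

/-- The affine plactic Schur polynomial `det (h_{λᵢ - i + j})`, `1 ≤ i, j ≤ n - 1`. The entries
are operators; in the Leibniz expansion the factors are taken in the order of the rows. -/
def placticSchur {N k : ℕ} (lam : BoxPartition N k) : Module.End ℂ (State N) :=
  ∑ w : Equiv.Perm (Fin N), ((Equiv.Perm.sign w : ℤ) : ℂ) •
    (List.ofFn fun i : Fin N =>
      placticHInt N (((lam.1 i : ℕ) : ℤ) - ((i : ℕ) : ℤ) + ((w i : ℕ) : ℤ))).prod

/-! ### Restriction to a fixed level -/

/-- The level spaces indexed by integers (zero for negative index); used only to see that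
the affine plactic polynomials preserve every level. -/
def levelInt (N : ℕ) (d : ℤ) : Submodule ℂ (State N) :=
  Finsupp.supported ℂ ℂ {m | ((∑ i, m i : ℕ) : ℤ) = d}

theorem level_eq_levelInt (N k : ℕ) : level N k = levelInt N k := by
  simp only [level, levelInt, Nat.cast_inj]

theorem sum_update_int {N : ℕ} (m : Fin (N + 1) → ℕ) (i : Fin (N + 1)) (a : ℕ) :
    ((∑ j, Function.update m i a j : ℕ) : ℤ) = ((∑ j, m j : ℕ) : ℤ) - (m i : ℤ) + (a : ℤ) := by
  have h1 := Finset.sum_update_of_mem (Finset.mem_univ i) m a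
  have h2 := Finset.add_sum_erase Finset.univ m (Finset.mem_univ i)
  rw [Finset.sdiff_singleton_eq_erase] at h1
  omega

/-- `f` maps level `e` to level `e + d`, for every `e`. -/
def Shifts {N : ℕ} (d : ℤ) (f : Module.End ℂ (State N)) : Prop :=
  ∀ e : ℤ, ∀ x ∈ levelInt N e, f x ∈ levelInt N (e + d)

theorem shifts_linearCombination {N : ℕ} (d : ℤ) (g : (Fin (N + 1) → ℕ) → State N)
    (hg : ∀ m, g m ∈ levelInt N (((∑ i, m i : ℕ) : ℤ) + d)) :
    Shifts d (Finsupp.linearCombination ℂ g) := by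
  intro e x hx
  rw [Finsupp.linearCombination_apply]
  refine Submodule.sum_mem _ fun m hm => Submodule.smul_mem _ _ ?_
  have h : ((∑ i, m i : ℕ) : ℤ) = e := hx hm
  exact h ▸ hg m

theorem shifts_phiStar {N : ℕ} (i : Fin (N + 1)) : Shifts 1 (phiStar i) := by
  refine shifts_linearCombination _ _ fun m => Finsupp.single_mem_supported ℂ _ ?_
  rw [Set.mem_ofPred_eq, sum_update_int]
  push_cast
  ring

theorem shifts_phi {N : ℕ} (i : Fin (N + 1)) : Shifts (-1) (phi i) := by
  refine shifts_linearCombination _ _ fun m => ?_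
  split_ifs with h
  · refine Finsupp.single_mem_supported ℂ _ ?_
    rw [Set.mem_ofPred_eq, sum_update_int]
    omega
  · exact Submodule.zero_mem _

theorem Shifts.mul {N : ℕ} {d d' : ℤ} {f g : Module.End ℂ (State N)} (hf : Shifts d f)
    (hg : Shifts d' g) : Shifts (d' + d) (f * g) := by
  intro e x hx
  rw [← add_assoc]
  exact hf _ _ (hg e x hx)

theorem shifts_one (N : ℕ) : Shifts 0 (1 : Module.End ℂ (State N)) := by
  intro e x hx
  simpa using hx

theorem Shifts.pow {N : ℕ} {d : ℤ} {f : Module.End ℂ (State N)} (hf : Shifts d f) (r : ℕ) :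
    Shifts (r * d) (f ^ r) := by
  induction r with
  | zero => simpa using shifts_one N
  | succ r ih =>
    have h := ih.mul hf
    rw [← pow_succ] at h
    convert h using 1
    push_cast
    ring

theorem shifts_list_prod {N : ℕ} (l : List (Module.End ℂ (State N)))
    (hl : ∀ f ∈ l, Shifts 0 f) : Shifts 0 l.prod := by
  induction l with
  | nil => simpa using shifts_one N
  | cons f l ih =>
    rw [List.prod_cons]
    simpa using (hl f (by simp)).mul (ih fun g hg => hl g (by simp [hg]))

theorem shifts_placticH (N r : ℕ) : Shifts 0 (placticH N r) := by
  intro e x hx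
  rw [placticH, LinearMap.sum_apply]
  refine Submodule.sum_mem _ fun ε _ => ?_
  have ha : Shifts 0 (List.ofFn fun j : Fin N => plactic j ^ ε j.succ).prod := by
    refine shifts_list_prod _ fun f hf => ?_
    obtain ⟨j, rfl⟩ := (List.mem_ofFn' _ _).1 hf
    have h := ((shifts_phiStar j.succ).mul (shifts_phi j.castSucc)).pow (ε j.succ)
    simpa [plactic] using h
  have h := (((shifts_phiStar (N := N) 0).pow (ε 0)).mul ha).mul
    ((shifts_phi (Fin.last N)).pow (ε 0)) e x hx
  simpa using h

theorem shifts_placticHInt (N : ℕ) (r : ℤ) : Shifts 0 (placticHInt N r) := by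
  unfold placticHInt
  split_ifs
  · exact shifts_placticH _ _
  · intro e x _
    exact Submodule.zero_mem _

theorem placticSchur_mem_level {N k : ℕ} (lam : BoxPartition N k) :
    ∀ x ∈ level N k, placticSchur lam x ∈ level N k := by
  intro x hx
  rw [level_eq_levelInt] at hx ⊢
  rw [placticSchur, LinearMap.sum_apply]
  refine Submodule.sum_mem _ fun w _ => Submodule.smul_mem _ _ ?_
  have h := shifts_list_prod (N := N) (List.ofFn fun i : Fin N =>
      placticHInt N (((lam.1 i : ℕ) : ℤ) - ((i : ℕ) : ℤ) + ((w i : ℕ) : ℤ))) (by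
    intro f hf
    obtain ⟨i, rfl⟩ := (List.mem_ofFn' _ _).1 hf
    exact shifts_placticHInt _ _) _ x hx
  simpa using h

/-- The affine plactic Schur polynomial restricted to `ℂP⁺ₖ`. -/
def placticSchurLevel {N k : ℕ} (lam : BoxPartition N k) : Module.End ℂ (level N k) :=
  (placticSchur lam).restrict (placticSchur_mem_level lam)

/-- The subalgebra of `End ℂP⁺ₖ` generated by the restricted affine plactic Schur polynomials. -/
def placticSchurAlgebra (N k : ℕ) : Subalgebra ℂ (Module.End ℂ (level N k)) :=
  Algebra.adjoin ℂ (Set.range (placticSchurLevel (N := N) (k := k)))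

/-- The restricted affine plactic Schur polynomial as an element of that subalgebra. -/
def placticSchurGen {N k : ℕ} (lam : BoxPartition N k) : placticSchurAlgebra N k :=
  ⟨placticSchurLevel lam, Algebra.subset_adjoin ⟨lam, rfl⟩⟩

/-! ### Weights, the modular S-matrix and the fusion coefficients -/

/-- The part `λ_{i+1}` of a partition (`i` counts from `0`), with `λₙ = 0`. -/
def part {N k : ℕ} (lam : BoxPartition N k) (i : ℕ) : ℕ :=
  if h : i < N then (lam.1 ⟨i, h⟩ : ℕ) else 0

/-- The Dynkin labels of the affine weight of level `k` of a partition: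
`mᵢ = λᵢ - λᵢ₊₁` for `1 ≤ i ≤ n - 1`, and `mₙ = k - λ₁`. -/
def dynkin {N k : ℕ} (lam : BoxPartition N k) (i : Fin (N + 1)) : ℕ :=
  if i = Fin.last N then k - part lam 0 else part lam i - part lam (i + 1)

theorem sum_dynkin {N k : ℕ} (lam : BoxPartition N k) : ∑ i, dynkin lam i = k := by
  have hp : Antitone (part lam) := by
    intro i j hij
    unfold part
    split_ifs with h1 h2
    · exact lam.2 (show (⟨i, h2⟩ : Fin N) ≤ ⟨j, h1⟩ from hij)
    · omega
    · exact Nat.zero_le _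
    · exact le_rfl
  have h0 : part lam 0 ≤ k := by
    unfold part
    split_ifs
    · exact Nat.lt_succ_iff.1 (lam.1 _).2
    · exact Nat.zero_le _
  have hN : part lam N = 0 := by simp [part]
  have hsum : ∀ M : ℕ,
      ∑ i ∈ Finset.range M, (part lam i - part lam (i + 1)) = part lam 0 - part lam M := by
    intro M
    induction M with
    | zero => simp
    | succ M ih =>
      rw [Finset.sum_range_succ, ih]
      have h3 := hp (Nat.zero_le M)
      have h4 := hp (Nat.le_succ M)
      simp only [Nat.succ_eq_add_one] at h4
      omega
  rw [Fin.sum_univ_castSucc]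
  have h1 : ∀ i : Fin N, dynkin lam i.castSucc = part lam i - part lam (i + 1) := fun i => by
    simp [dynkin, (Fin.castSucc_lt_last i).ne]
  have h2 : dynkin lam (Fin.last N) = k - part lam 0 := by simp [dynkin]
  rw [Finset.sum_congr rfl fun i _ => h1 i, h2,
    Fin.sum_univ_eq_sum_range (fun i => part lam i - part lam (i + 1)) N,
    hsum N, hN]
  omega

/-- The basis vector of `ℂP⁺ₖ` given by the affine weight of a partition. -/
def weightVec {N k : ℕ} (lam : BoxPartition N k) : level N k :=
  ⟨Finsupp.single (dynkin lam) 1, Finsupp.single_mem_supported ℂ _ (sum_dynkin lam)⟩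

/-- The coordinates in `ℝⁿ` of the finite weight `λ` plus the Weyl vector `ρ`: the `i`-th
coordinate is `(λᵢ - |λ| / n) + ((n + 1) / 2 - i)` for `1 ≤ i ≤ n`. -/
def shiftedWeight {N k : ℕ} (lam : BoxPartition N k) (i : Fin (N + 1)) : ℝ :=
  ((part lam i : ℝ) - (∑ j : Fin N, ((lam.1 j : ℕ) : ℝ)) / ((N : ℝ) + 1)) +
    ((N : ℝ) / 2 - ((i : ℕ) : ℝ))

/-- The modular `S`-matrix of affine `su(n)` at level `k`, given by the Kac-Peterson formula
(the Weyl group is the symmetric group, permuting coordinates). -/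
def modularS (N k : ℕ) : Matrix (BoxPartition N k) (BoxPartition N k) ℂ :=
  Matrix.of fun lam sig =>
    Complex.exp (Complex.I * Real.pi * ((N : ℂ) + 1) * (N : ℂ) / 4) /
        (Real.sqrt (((N : ℝ) + 1) * ((k : ℝ) + (N : ℝ) + 1) ^ N) : ℂ) *
      ∑ w : Equiv.Perm (Fin (N + 1)), ((Equiv.Perm.sign w : ℤ) : ℂ) *
        Complex.exp (-(2 * Real.pi * Complex.I / ((k : ℂ) + (N : ℂ) + 1)) *
          ((∑ i, shiftedWeight sig i * shiftedWeight lam (w⁻¹ i) : ℝ) : ℂ))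

/-- The empty partition. -/
def emptyPartition (N k : ℕ) : BoxPartition N k := ⟨fun _ => 0, fun _ _ _ => le_rfl⟩

/-- The fusion coefficients, given by the Verlinde formula. -/
def fusionCoeff {N k : ℕ} (lam mu nu : BoxPartition N k) : ℂ :=
  ∑ sig : BoxPartition N k,
    modularS N k lam sig * modularS N k mu sig * (modularS N k)⁻¹ nu sig /
      modularS N k (emptyPartition N k) sig

/-! ### Schur polynomials -/

/-- The Young diagram of a partition (rows and columns counted from `0`). -/
def diagram {N k : ℕ} (lam : BoxPartition N k) : YoungDiagram where
  cells := (Finset.range N ×ˢ Finset.range k).filter fun c => c.2 < part lam c.1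
  isLowerSet := by
    rintro ⟨i, j⟩ ⟨i', j'⟩ ⟨hi, hj⟩ h
    simp only [Finset.coe_filter, Finset.mem_product, Finset.mem_range, Set.mem_ofPred_eq]
      at hi hj h ⊢
    obtain ⟨⟨h1, h2⟩, h3⟩ := h
    have hi' : i' < N := by omega
    refine ⟨⟨hi', by omega⟩, ?_⟩
    have hle : part lam i ≤ part lam i' := by
      simp only [part, h1, hi', dif_pos]
      exact lam.2 (show (⟨i', hi'⟩ : Fin N) ≤ ⟨i, h1⟩ from hi)
    omega

/-- A filling of a Young diagram with letters `1, ..., l` is semistandard if it is weakly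
increasing along rows and strictly increasing down columns. -/
def IsSemistandard {l : ℕ} (mu : YoungDiagram) (T : mu.cells → Fin l) : Prop :=
  (∀ c d : mu.cells, c.1.1 = d.1.1 → c.1.2 < d.1.2 → T c ≤ T d) ∧
    ∀ c d : mu.cells, c.1.2 = d.1.2 → c.1.1 < d.1.1 → T c < T d

open scoped Classical in
/-- The Schur polynomial `s_μ(x₁, ..., x_l)` as the weighted sum of semistandard tableaux. -/
def schurPoly (l : ℕ) (mu : YoungDiagram) : MvPolynomial (Fin l) ℂ :=
  ∑ T : mu.cells → Fin l with IsSemistandard mu T, ∏ c, MvPolynomial.X (T c)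

/-! ### The Bethe variety -/

/-- The element `e_r` of `ℂ[e₁, ..., e_k]`, with `e₀ = 1` and `e_r = 0` for `r < 0` and `r > k`;
the polynomial variable with index `r - 1` stands for `e_r`. -/
def eVar (k : ℕ) (r : ℤ) : MvPolynomial (Fin k) ℂ :=
  if r = 0 then 1
  else if h : 1 ≤ r ∧ r ≤ k then MvPolynomial.X ⟨(r - 1).toNat, by omega⟩
  else 0

/-- `h_r = det (e_{1 - i + j})`, `1 ≤ i, j ≤ r`, in `ℂ[e₁, ..., e_k]`. -/
def hPoly (k r : ℕ) : MvPolynomial (Fin k) ℂ :=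
  (Matrix.of fun i j : Fin r => eVar k (1 - ((i : ℕ) : ℤ) + ((j : ℕ) : ℤ))).det

/-- The variety `V(h_n - 1, h_{n+1}, ..., h_{n+k-1})` in `ℂ^k`, with coordinates
`e₁, ..., e_k`. -/
def betheVariety (n k : ℕ) : Set (Fin k → ℂ) :=
  MvPolynomial.zeroLocus ℂ (Ideal.span
    (Set.range fun i : Fin k => hPoly k (n + i) - if (i : ℕ) = 0 then 1 else 0))

/-- The vanishing ideal of the Bethe variety in `ℂ[e₁, ..., e_k]`. -/
def betheIdeal (n k : ℕ) : Ideal (MvPolynomial (Fin k) ℂ) :=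
  MvPolynomial.vanishingIdeal ℂ (betheVariety n k)

end PhaseModel

end

open PhaseModel

noncomputable section
namespace PhaseModel

/-! ### The action of the complete symmetric polynomials on basis vectors -/

/-! The operator h_r(a) moves r particles one step each around a circle of n = N + 1 sites. Encode a
state m by the strictly decreasing exponents l_j = λ_j + N - j (`expo`) and send it to the alternant
det(ξ_i^{l_j}). Moving ε_j particles into site j raises l_j by ε_j, up to a common shift of all
exponents, which is invisible when ∏ ξ_i = 1. If the ξ_i also share their (n + k)-th power c, the
generating function of these alternants telescopes: after multiplication by ∏ (1 - ξ_i X) its matrix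
becomes the alternant matrix times 1 - W, with W a weighted cyclic shift, and det(1 - W) = 1 - c
X^{n+k}. Hence the alternants in ξ form a left eigenvector of every h_r(a), r < n + k, with
eigenvalue h_r(ξ) (`IsBetheRoot.functional_placticH`), and s_λ(a) acts on it by the Jacobi-Trudi
value s_λ(ξ). No commutation relation among the operators is needed.

Each σ in the box gives a solution ξ_σ, the exponentials of the coordinates of σ + ρ. Different σ
are separated by the values h_r(ξ), r ≤ k, so their functionals are linearly independent; they are
as many as the basis states, hence a basis of the dual space, and counting leaves no room for
further solutions (`IsBetheRoot.exists_hTrunc_eq`). The matrix of alternants is a nonzero multiple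
of the modular S-matrix, and the bialternant formula gives S_{λσ} / S_{∅σ} = s_λ(ξ_σ). The Verlinde
formula then says that the fusion matrices have the same left eigenvectors and eigenvalues as the
s_λ(a), which yields (2) and (3).

For (1), the polynomial identity ∏ (1 - ξ_i X) · ∑_{r ≤ k} h_r(ξ) X^r = 1 - c X^{n+k} exchanges rank
and level: the numbers h_r(ξ_σ) are the coordinates e_r of the points of the Bethe variety, and
every point arises so. Both algebras are therefore the algebra of all functions on the set of box
partitions, and s_λ(a) corresponds to det(e_{λ_i - i + j}). Dual Jacobi-Trudi, proved by stripping
the largest letter from tableaux, identifies this determinant with s_{λ^t}. -/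

theorem phiStar_single {N : ℕ} (i : Fin (N + 1)) (m : Fin (N + 1) → ℕ) :
    phiStar i (Finsupp.single m 1) = Finsupp.single (m + Pi.single i 1) 1 := by
  rw [phiStar, Finsupp.linearCombination_single, one_smul]
  congr 1
  ext j
  rcases eq_or_ne j i with rfl | h <;> simp [*]

theorem phi_single {N : ℕ} (i : Fin (N + 1)) (m : Fin (N + 1) → ℕ) :
    phi i (Finsupp.single m 1) = if 0 < m i then Finsupp.single (m - Pi.single i 1) 1 else 0 := by
  rw [phi, Finsupp.linearCombination_single, one_smul]
  congr 2
  ext j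
  rcases eq_or_ne j i with rfl | h <;> simp [*]

theorem phiStar_pow_single {N : ℕ} (i : Fin (N + 1)) (m : Fin (N + 1) → ℕ) (r : ℕ) :
    (phiStar i ^ r) (Finsupp.single m 1) = Finsupp.single (m + Pi.single i r) 1 := by
  induction r with
  | zero => simp
  | succ r ih =>
    rw [pow_succ', Module.End.mul_apply, ih, phiStar_single, add_assoc, ← Pi.single_add]

theorem phi_pow_single {N : ℕ} (i : Fin (N + 1)) (m : Fin (N + 1) → ℕ) (r : ℕ) :
    (phi i ^ r) (Finsupp.single m 1) =
      if r ≤ m i then Finsupp.single (m - Pi.single i r) 1 else 0 := by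
  induction r with
  | zero => simp
  | succ r ih =>
    rw [pow_succ', Module.End.mul_apply, ih]
    by_cases h : r ≤ m i
    · rw [if_pos h, phi_single]
      have : (m - Pi.single i r : Fin (N + 1) → ℕ) i = m i - r := by simp
      rw [this]
      by_cases h' : r + 1 ≤ m i
      · rw [if_pos (by omega), if_pos h', tsub_tsub, ← Pi.single_add]
      · rw [if_neg (by omega), if_neg h']
    · rw [if_neg h, map_zero, if_neg (by omega)]

theorem plactic_single {N : ℕ} (j : Fin N) (m : Fin (N + 1) → ℕ) :
    plactic j (Finsupp.single m 1) = if 0 < m j.castSucc then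
      Finsupp.single (m - Pi.single j.castSucc 1 + Pi.single j.succ 1) 1 else 0 := by
  rw [plactic, Module.End.mul_apply, phi_single]
  split_ifs
  · rw [phiStar_single]
  · rw [map_zero]

theorem plactic_pow_single {N : ℕ} (j : Fin N) (m : Fin (N + 1) → ℕ) (r : ℕ) :
    (plactic j ^ r) (Finsupp.single m 1) = if r ≤ m j.castSucc then
      Finsupp.single (m - Pi.single j.castSucc r + Pi.single j.succ r) 1 else 0 := by
  have hne : j.castSucc ≠ j.succ := (Fin.castSucc_lt_succ).ne
  induction r with
  | zero => simp
  | succ r ih =>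
    rw [pow_succ', Module.End.mul_apply, ih]
    by_cases h : r ≤ m j.castSucc
    · rw [if_pos h, plactic_single]
      have : (m - Pi.single j.castSucc r + Pi.single j.succ r : Fin (N + 1) → ℕ) j.castSucc =
          m j.castSucc - r := by
        simp [hne]
      rw [this]
      by_cases h' : r + 1 ≤ m j.castSucc
      · rw [if_pos (by omega), if_pos h']
        congr 1
        ext i
        rcases eq_or_ne i j.castSucc with rfl | h1
        · simp [hne]; omega
        · rcases eq_or_ne i j.succ with rfl | h2
          · simp [hne.symm]; omega
          · simp [h1, h2]
      · rw [if_neg (by omega), if_neg h']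
    · rw [if_neg h, map_zero, if_neg (by omega)]

/-- An ordered product of powers of plactic generators moves particles simultaneously. -/
theorem list_prod_plactic_single {N : ℕ} (ε : Fin N → ℕ) (l : List (Fin N))
    (hl : l.Pairwise (· < ·)) (m : Fin (N + 1) → ℕ) :
    (l.map fun j => plactic j ^ ε j).prod (Finsupp.single m 1) =
      if ∀ j ∈ l, ε j ≤ m j.castSucc then
        Finsupp.single (m - (l.map fun j => Pi.single j.castSucc (ε j)).sum +
          (l.map fun j => Pi.single j.succ (ε j)).sum) 1
      else 0 := by
  induction l with
  | nil => simp
  | cons j l ih =>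
    obtain ⟨hj, hl⟩ := List.pairwise_cons.1 hl
    rw [List.map_cons, List.prod_cons, Module.End.mul_apply, ih hl]
    -- The factors to the right act first and involve only sites beyond j, both as sources and as
    -- targets. So `plactic j ^ ε j` still sees the original occupation of its source.
    have h1 : (l.map fun i => (Pi.single i.castSucc (ε i) : Fin (N + 1) → ℕ)).sum j.castSucc
        = 0 := by
      rw [Pi.list_sum_apply, List.map_map]
      refine List.sum_eq_zero fun x hx => ?_
      obtain ⟨i, hi, rfl⟩ := List.mem_map.1 hx
      have := hj i hi
      exact Pi.single_eq_of_ne (by simp [this.ne]) _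
    have h2 : (l.map fun i => (Pi.single i.succ (ε i) : Fin (N + 1) → ℕ)).sum j.castSucc = 0 := by
      rw [Pi.list_sum_apply, List.map_map]
      refine List.sum_eq_zero fun x hx => ?_
      obtain ⟨i, hi, rfl⟩ := List.mem_map.1 hx
      have := hj i hi
      refine Pi.single_eq_of_ne (fun h => ?_) _
      rw [Fin.ext_iff] at h
      simp only [Fin.val_castSucc, Fin.val_succ] at h
      rw [Fin.lt_def] at this
      omega
    simp only [List.forall_mem_cons, List.map_cons, List.sum_cons]
    by_cases hA : ∀ i ∈ l, ε i ≤ m i.castSucc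
    · rw [if_pos hA, plactic_pow_single]
      simp only [Pi.add_apply, Pi.sub_apply, h1, h2, tsub_zero, add_zero]
      by_cases hB : ε j ≤ m j.castSucc
      · rw [if_pos hB, if_pos ⟨hB, hA⟩]
        congr 1
        ext i
        simp only [Pi.add_apply, Pi.sub_apply]
        rcases eq_or_ne i j.castSucc with rfl | h
        · rw [h1, h2]; simp
        · rw [Pi.single_eq_of_ne h]; omega
      · rw [if_neg hB, if_neg fun h => hB h.1]
    · rw [if_neg hA, map_zero, if_neg fun h => hA h.2]

/-- The largest number of particles that can arrive at a site: the occupation of the preceding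
site in the cyclic order. -/
def inflowBound {N : ℕ} (m : Fin (N + 1) → ℕ) : Fin (N + 1) → ℕ :=
  Fin.cons (m (Fin.last N)) fun j => m j.castSucc

/-- The configuration obtained from `m` when `ε j` particles arrive at site `j` from the preceding
site, simultaneously for all `j`. -/
def inflow {N : ℕ} (m ε : Fin (N + 1) → ℕ) (i : Fin (N + 1)) : ℕ :=
  m i - (Fin.snoc (fun j : Fin N => ε j.succ) (ε 0) : Fin (N + 1) → ℕ) i + ε i

/-- Particles leaving the last site are removed first and reinserted at the first site at the very
end, and the factors between act from right to left. So no particle moves twice, and the only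
constraints compare ε with the original occupations. -/
theorem placticH_single {N : ℕ} (r : ℕ) (m : Fin (N + 1) → ℕ) :
    placticH N r (Finsupp.single m 1) =
      ∑ ε ∈ Finset.piAntidiag (Finset.univ : Finset (Fin (N + 1))) r with ∀ j, ε j ≤ inflowBound m j,
        Finsupp.single (inflow m ε) 1 := by
  rw [placticH, LinearMap.sum_apply, Finset.sum_filter]
  refine Finset.sum_congr rfl fun ε _ => ?_
  have hle : (∀ j, ε j ≤ inflowBound m j) ↔
      ε 0 ≤ m (Fin.last N) ∧ ∀ j : Fin N, ε j.succ ≤ m j.castSucc := by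
    rw [Fin.forall_fin_succ]
    simp [inflowBound]
  rw [Module.End.mul_apply, Module.End.mul_apply, phi_pow_single]
  simp only [hle]
  by_cases h0 : ε 0 ≤ m (Fin.last N)
  swap
  · rw [if_neg h0, map_zero, map_zero, if_neg fun h => h0 h.1]
  rw [if_pos h0, List.ofFn_eq_map, list_prod_plactic_single (fun j => ε j.succ) _
    (List.pairwise_lt_finRange N)]
  have hc : ∀ j : Fin N, (m - Pi.single (Fin.last N) (ε 0) : Fin (N + 1) → ℕ) j.castSucc =
      m j.castSucc := by
    intro j
    rw [Pi.sub_apply, Pi.single_eq_of_ne (Fin.castSucc_lt_last j).ne, tsub_zero]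
  simp only [List.mem_finRange, true_imp_iff, hc]
  by_cases h1 : ∀ j : Fin N, ε j.succ ≤ m j.castSucc
  swap
  · rw [if_neg h1, map_zero, if_neg fun h => h1 h.2]
  rw [if_pos h1, if_pos ⟨h0, h1⟩, phiStar_pow_single]
  congr 1
  ext i
  have e1 : ((List.finRange N).map fun j => (Pi.single j.castSucc (ε j.succ) :
      Fin (N + 1) → ℕ)).sum = Fin.snoc (fun j : Fin N => ε j.succ) 0 := by
    rw [← List.ofFn_eq_map, List.sum_ofFn]
    ext i
    rw [Finset.sum_apply]
    refine Fin.lastCases ?_ (fun i => ?_) i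
    · rw [Fin.snoc_last]
      exact Finset.sum_eq_zero fun j _ => Pi.single_eq_of_ne (Fin.castSucc_lt_last j).ne' _
    · rw [Fin.snoc_castSucc, Finset.sum_eq_single i]
      · simp
      · intro j _ h
        exact Pi.single_eq_of_ne (by simpa using h.symm) _
      · simp
  have e2 : ((List.finRange N).map fun j => (Pi.single j.succ (ε j.succ) :
      Fin (N + 1) → ℕ)).sum = Fin.cons 0 (fun j : Fin N => ε j.succ) := by
    rw [← List.ofFn_eq_map, List.sum_ofFn]
    ext i
    rw [Finset.sum_apply]
    refine Fin.cases ?_ (fun i => ?_) i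
    · rw [Fin.cons_zero]
      exact Finset.sum_eq_zero fun j _ => Pi.single_eq_of_ne (Fin.succ_ne_zero j).symm _
    · rw [Fin.cons_succ, Finset.sum_eq_single i]
      · simp
      · intro j _ h
        exact Pi.single_eq_of_ne (by simpa using h.symm) _
      · simp
  rw [e1, e2]
  have e3 : (Fin.cons 0 (fun j : Fin N => ε j.succ) : Fin (N + 1) → ℕ) i +
      (Pi.single 0 (ε 0) : Fin (N + 1) → ℕ) i = ε i := by
    refine Fin.cases ?_ (fun i => ?_) i <;> simp
  have e4 : m i - (Pi.single (Fin.last N) (ε 0) : Fin (N + 1) → ℕ) i -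
      (Fin.snoc (fun j : Fin N => ε j.succ) 0 : Fin (N + 1) → ℕ) i =
      m i - (Fin.snoc (fun j : Fin N => ε j.succ) (ε 0) : Fin (N + 1) → ℕ) i := by
    refine Fin.lastCases ?_ (fun i => ?_) i
    · simp
    · simp [(Fin.castSucc_lt_last i).ne]
  simp only [Pi.add_apply, Pi.sub_apply, inflow]
  rw [e4, add_assoc, e3]

/-- The exponents of the alternant attached to a state: `l_j = ∑_{j ≤ i < N} (m_i + 1)`. -/
def expo {N : ℕ} (m : Fin (N + 1) → ℕ) (j : Fin (N + 1)) : ℕ :=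
  ∑ i : Fin N with j ≤ i.castSucc, (m i.castSucc + 1)

theorem expo_last {N : ℕ} (m : Fin (N + 1) → ℕ) : expo m (Fin.last N) = 0 := by
  rw [expo, Finset.filter_false_of_mem, Finset.sum_empty]
  intro i _ h
  exact absurd (Fin.castSucc_lt_last i) (not_lt.2 h)

theorem expo_castSucc {N : ℕ} (m : Fin (N + 1) → ℕ) (j : Fin N) :
    expo m j.castSucc = m j.castSucc + 1 + expo m j.succ := by
  have : (Finset.univ.filter fun i : Fin N => j.castSucc ≤ i.castSucc) =
      insert j (Finset.univ.filter fun i : Fin N => j.succ ≤ i.castSucc) := by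
    ext i
    simp only [Finset.mem_filter, Finset.mem_univ, true_and, Finset.mem_insert, Fin.le_def,
      Fin.val_castSucc, Fin.val_succ, Fin.ext_iff]
    omega
  rw [expo, this, Finset.sum_insert, expo]
  simp [Fin.le_def]

theorem expo_zero {N : ℕ} (m : Fin (N + 1) → ℕ) :
    expo m 0 + m (Fin.last N) = ∑ i, m i + N := by
  rw [Fin.sum_univ_castSucc, expo]
  simp [Finset.sum_add_distrib]
  ring

/-- Site i loses ε (i + 1) and gains ε i, so the tail sums telescope. The leftover `ε (Fin.last N)`
is independent of j and will only multiply an alternant by a power of ∏ ξ_i. -/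
theorem expo_inflow {N : ℕ} (m ε : Fin (N + 1) → ℕ) (h : ∀ j, ε j ≤ inflowBound m j)
    (j : Fin (N + 1)) :
    expo (inflow m ε) j + ε (Fin.last N) = expo m j + ε j := by
  induction j using Fin.reverseInduction with
  | last => rw [expo_last, expo_last]
  | cast j ih =>
    rw [expo_castSucc, expo_castSucc]
    have h1 : ε j.succ ≤ m j.castSucc := by simpa [inflowBound] using h j.succ
    have h2 : inflow m ε j.castSucc = m j.castSucc - ε j.succ + ε j.castSucc := by
      simp [inflow]
    omega

/-! ### A cyclic determinant and the Pieri rule for alternants -/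

/-- The matrix `1 - W` where `W` is the weighted permutation matrix of the cycle `j ↦ j - 1`. -/
def oneSubCycle {R : Type*} [CommRing R] {N : ℕ} (w : Fin (N + 1) → R) :
    Matrix (Fin (N + 1)) (Fin (N + 1)) R :=
  Matrix.of fun i j => (if i = j then 1 else 0) -
    (Fin.cons (if i = Fin.last N then w 0 else 0)
      (fun j' : Fin N => if i = j'.castSucc then w j'.succ else 0) : Fin (N + 1) → R) j

/-- Only the identity and the full cycle contribute to the determinant. For at least two sites,
column 0 has nonzero entries at most in its first and last rows, and both minors are triangular. -/
theorem det_oneSubCycle {R : Type*} [CommRing R] {N : ℕ} (w : Fin (N + 1) → R) :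
    (oneSubCycle w).det = 1 - ∏ j, w j := by
  cases N with
  | zero => simp [oneSubCycle]
  | succ M =>
    rw [Matrix.det_succ_column_zero, Finset.sum_eq_add (0 : Fin (M + 2)) (Fin.last (M + 1))
      (by simp [Fin.ext_iff])]
    · have h1 : ((oneSubCycle w).submatrix (Fin.succAbove 0) Fin.succ).det = 1 := by
        rw [Matrix.det_of_isUpperTriangular]
        · refine Finset.prod_eq_one fun i _ => ?_
          have : i.succ ≠ i.castSucc := Fin.castSucc_lt_succ.ne'
          simp [oneSubCycle, this]
        · intro i j hij
          have hij : j < i := hij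
          rw [Fin.lt_def] at hij
          have h1 : i.succ ≠ j.succ := fun h => by
            simp only [Fin.ext_iff, Fin.val_succ] at h; omega
          have h2 : i.succ ≠ j.castSucc := fun h => by
            simp only [Fin.ext_iff, Fin.val_succ, Fin.val_castSucc] at h; omega
          simp [oneSubCycle, h1, h2]
      have h2 : ((oneSubCycle w).submatrix (Fin.last (M + 1)).succAbove Fin.succ).det =
          ∏ j : Fin (M + 1), -w j.succ := by
        rw [Matrix.det_of_isLowerTriangular]
        · refine Finset.prod_congr rfl fun i _ => ?_
          have : i.castSucc ≠ i.succ := Fin.castSucc_lt_succ.ne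
          simp [oneSubCycle, this]
        · intro i j hij
          have hij : i < j := hij
          rw [Fin.lt_def] at hij
          have h1 : i.castSucc ≠ j.succ := fun h => by
            simp only [Fin.ext_iff, Fin.val_succ, Fin.val_castSucc] at h; omega
          have h2 : i ≠ j := fun h => by
            simp only [Fin.ext_iff] at h; omega
          simp [oneSubCycle, h1, h2]
      have h3 : oneSubCycle w 0 0 = 1 := by
        have : (0 : Fin (M + 2)) ≠ Fin.last (M + 1) := by simp [Fin.ext_iff]
        simp [oneSubCycle, this]
      have h4 : oneSubCycle w (Fin.last (M + 1)) 0 = -w 0 := by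
        have : Fin.last (M + 1) ≠ 0 := by simp [Fin.ext_iff]
        simp [oneSubCycle, this]
      rw [h1, h2, h3, h4, Fin.prod_univ_succ w, Finset.prod_neg]
      have h5 : ((-1 : R) ^ (M + 1)) * (-1) ^ (M + 1) = 1 := by
        rw [← mul_pow]; simp
      simp only [Fin.val_last, Finset.card_univ, Fintype.card_fin, Fin.val_zero, pow_zero]
      linear_combination (-w 0 * ∏ j : Fin (M + 1), w j.succ) * h5
    · rintro i - ⟨h1, h2⟩
      have : oneSubCycle w i 0 = 0 := by simp [oneSubCycle, h1, h2]
      rw [this]; ring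
    · simp
    · simp

/-- The alternant `det (ξ_i ^ l_j)`. -/
def alternant {N : ℕ} (ξ : Fin (N + 1) → ℂ) (l : Fin (N + 1) → ℕ) : ℂ :=
  (Matrix.of fun i j => ξ i ^ l j).det

/-- The polynomial `∏ (1 - ξ_i X)`. -/
def revPoly {N : ℕ} (ξ : Fin (N + 1) → ℂ) : Polynomial ℂ :=
  ∏ i, (1 - Polynomial.C (ξ i) * Polynomial.X)

/-- Generating matrix of the alternants with exponents `l + ε`, `ε ≤ b`. -/
def pieriMatrix {N : ℕ} (ξ : Fin (N + 1) → ℂ) (l b : Fin (N + 1) → ℕ) :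
    Matrix (Fin (N + 1)) (Fin (N + 1)) (Polynomial ℂ) :=
  Matrix.of fun i j =>
    ∑ α ∈ Finset.range (b j + 1), Polynomial.X ^ α * Polynomial.C (ξ i ^ (l j + α))

/-- Each column is a sum over its own exponent increment, so multilinearity in the columns expands
the determinant over all ε, and the power of X comes out of each column. -/
theorem pieriMatrix_det {N : ℕ} (ξ : Fin (N + 1) → ℂ) (l b : Fin (N + 1) → ℕ) :
    (pieriMatrix ξ l b).det = ∑ ε ∈ Fintype.piFinset fun j => Finset.range (b j + 1),
      Polynomial.X ^ (∑ j, ε j) * Polynomial.C (alternant ξ fun j => l j + ε j) := by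
  rw [← Matrix.det_transpose]
  have h := MultilinearMap.map_sum_finset
    (Matrix.detRowAlternating (n := Fin (N + 1)) (R := Polynomial ℂ)).toMultilinearMap
    (fun (j : Fin (N + 1)) (α : ℕ) (i : Fin (N + 1)) =>
      (Polynomial.X ^ α * Polynomial.C (ξ i ^ (l j + α)) : Polynomial ℂ))
    (fun j => Finset.range (b j + 1))
  have h1 : (pieriMatrix ξ l b).transpose = fun j => ∑ α ∈ Finset.range (b j + 1),
      fun i => (Polynomial.X ^ α * Polynomial.C (ξ i ^ (l j + α)) : Polynomial ℂ) := by
    ext j i : 2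
    rw [Finset.sum_apply]
    rfl
  rw [h1]
  refine h.trans (Finset.sum_congr rfl fun ε _ => ?_)
  have h2 := Matrix.det_mul_column (fun j => (Polynomial.X : Polynomial ℂ) ^ ε j)
    ((Matrix.of fun i j => ξ i ^ (l j + ε j)).transpose.map Polynomial.C)
  rw [Finset.prod_pow_eq_pow_sum] at h2
  rw [alternant, ← Matrix.det_transpose, RingHom.map_det]
  exact h2

theorem coeff_pieriMatrix_det {N : ℕ} (ξ : Fin (N + 1) → ℂ) (l b : Fin (N + 1) → ℕ) (r : ℕ) :
    (pieriMatrix ξ l b).det.coeff r =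
      ∑ ε ∈ Finset.piAntidiag (Finset.univ : Finset (Fin (N + 1))) r with ∀ j, ε j ≤ b j,
        alternant ξ fun j => l j + ε j := by
  rw [pieriMatrix_det, Polynomial.finsetSum_coeff]
  simp only [Polynomial.coeff_mul_C, Polynomial.coeff_X_pow, ite_mul, one_mul, zero_mul]
  rw [← Finset.sum_filter]
  refine Finset.sum_congr ?_ fun _ _ => rfl
  ext ε
  simp only [Finset.mem_filter, Fintype.mem_piFinset, Finset.mem_range, Nat.lt_succ_iff,
    Finset.mem_piAntidiag, Finset.mem_univ, implies_true, and_true]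
  constructor
  · rintro ⟨h1, h2⟩; exact ⟨h2.symm, h1⟩
  · rintro ⟨h1, h2⟩; exact ⟨h2, h1.symm⟩

/-- Multiplying row i by 1 - ξ_i X sums the geometric progression in each entry and leaves its two
end terms. By `hl` the upper end of column j + 1 is the lower end of column j, and `h0` closes the
circle at the cost of c. The matrix thus factors through the cyclic matrix `oneSubCycle w`. -/
theorem revPoly_mul_det_pieriMatrix {N : ℕ} (ξ : Fin (N + 1) → ℂ) (c : ℂ)
    (l b : Fin (N + 1) → ℕ) (hl : ∀ j : Fin N, l j.castSucc = l j.succ + b j.succ + 1)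
    (h0 : ∀ i, ξ i ^ (l 0 + b 0 + 1) = c * ξ i ^ l (Fin.last N)) :
    revPoly ξ * (pieriMatrix ξ l b).det = Polynomial.C (alternant ξ l) *
      (1 - Polynomial.C c * Polynomial.X ^ ∑ j, (b j + 1)) := by
  -- The factor c sits on the single arrow that wraps around, from column 0 to the last column.
  set w : Fin (N + 1) → Polynomial ℂ := fun j =>
    (if j = 0 then Polynomial.C c else 1) * Polynomial.X ^ (b j + 1) with hw
  have hwp : ∏ j, w j = Polynomial.C c * Polynomial.X ^ ∑ j, (b j + 1) := by
    rw [hw, Finset.prod_mul_distrib, Finset.prod_pow_eq_pow_sum]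
    simp
  have hm : Matrix.diagonal (fun i => 1 - Polynomial.C (ξ i) * Polynomial.X) *
      pieriMatrix ξ l b = (Matrix.of fun i j => ξ i ^ l j).map Polynomial.C * oneSubCycle w := by
    refine Matrix.ext fun i j => ?_
    rw [Matrix.diagonal_mul, Matrix.mul_apply]
    have hgeo : (1 - Polynomial.C (ξ i) * Polynomial.X) * pieriMatrix ξ l b i j =
        Polynomial.C (ξ i ^ l j) -
          Polynomial.C (ξ i ^ (l j + b j + 1)) * Polynomial.X ^ (b j + 1) := by
      have h := mul_neg_geom_sum (Polynomial.C (ξ i) * Polynomial.X) (b j + 1)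
      have h2 : pieriMatrix ξ l b i j = Polynomial.C (ξ i ^ l j) *
          ∑ α ∈ Finset.range (b j + 1), (Polynomial.C (ξ i) * Polynomial.X) ^ α := by
        simp only [pieriMatrix, Matrix.of_apply, Finset.mul_sum]
        refine Finset.sum_congr rfl fun α _ => ?_
        rw [pow_add, Polynomial.C_mul, mul_pow, Polynomial.C_pow, Polynomial.C_pow]
        ring
      rw [h2, mul_left_comm, h, add_assoc, pow_add (ξ i), Polynomial.C_mul, mul_pow,
        Polynomial.C_pow, Polynomial.C_pow]
      ring
    rw [hgeo]
    simp only [oneSubCycle, Matrix.of_apply, Matrix.map_apply, mul_sub, Finset.sum_sub_distrib,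
      mul_ite, mul_one, mul_zero, Finset.sum_ite_eq', Finset.mem_univ, if_true]
    congr 1
    refine Fin.cases ?_ (fun j => ?_) j
    · simp only [Fin.cons_zero, mul_ite, mul_zero, Finset.sum_ite_eq', Finset.mem_univ, if_true]
      rw [h0 i, hw]
      simp only [if_true, Polynomial.C_mul]
      ring
    · simp only [Fin.cons_succ, mul_ite, mul_zero, Finset.sum_ite_eq', Finset.mem_univ, if_true]
      rw [hl j, hw]
      simp [Fin.succ_ne_zero]
  have hd := congrArg Matrix.det hm
  rw [Matrix.det_mul, Matrix.det_mul, Matrix.det_diagonal, det_oneSubCycle, hwp] at hd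
  rw [revPoly, hd, alternant, RingHom.map_det]
  rfl

/-- The generating series of the complete symmetric functions `h_r(ξ)`. -/
def hSeries {N : ℕ} (ξ : Fin (N + 1) → ℂ) : PowerSeries ℂ :=
  (revPoly ξ : PowerSeries ℂ)⁻¹

theorem revPoly_coeff_zero {N : ℕ} (ξ : Fin (N + 1) → ℂ) : (revPoly ξ).coeff 0 = 1 := by
  rw [Polynomial.coeff_zero_eq_eval_zero, revPoly, Polynomial.eval_prod]
  simp

theorem constantCoeff_revPoly {N : ℕ} (ξ : Fin (N + 1) → ℂ) :
    PowerSeries.constantCoeff (revPoly ξ : PowerSeries ℂ) = 1 := by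
  rw [← PowerSeries.coeff_zero_eq_constantCoeff_apply, Polynomial.coeff_coe, revPoly_coeff_zero]

theorem revPoly_mul_hSeries {N : ℕ} (ξ : Fin (N + 1) → ℂ) :
    (revPoly ξ : PowerSeries ℂ) * hSeries ξ = 1 :=
  PowerSeries.mul_inv_cancel _ (by rw [constantCoeff_revPoly]; exact one_ne_zero)

/-- The complete symmetric function `h_r(ξ)`. -/
def hCoeff {N : ℕ} (ξ : Fin (N + 1) → ℂ) (r : ℕ) : ℂ := PowerSeries.coeff r (hSeries ξ)

/-- Dividing by ∏ (1 - ξ_i X) gives a times the series of the h_r, and the term with X ^ L does not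
affect degrees below L. -/
theorem hCoeff_eq_of_mul {N : ℕ} (ξ : Fin (N + 1) → ℂ) (G : Polynomial ℂ) (a c : ℂ) (L : ℕ)
    (h : revPoly ξ * G = Polynomial.C a * (1 - Polynomial.C c * Polynomial.X ^ L)) {r : ℕ}
    (hr : r < L) : G.coeff r = a * hCoeff ξ r := by
  have h1 : (G : PowerSeries ℂ) = hSeries ξ * (PowerSeries.C a -
      PowerSeries.C (a * c) * PowerSeries.X ^ L) := by
    have h2 := congrArg (fun p : Polynomial ℂ => hSeries ξ * (p : PowerSeries ℂ)) h
    simp only [Polynomial.coe_mul, Polynomial.coe_sub, Polynomial.coe_C, Polynomial.coe_one,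
      Polynomial.coe_pow, Polynomial.coe_X] at h2
    rw [← mul_assoc, mul_comm (hSeries ξ), revPoly_mul_hSeries, one_mul] at h2
    rw [h2, map_mul]
    ring
  rw [← Polynomial.coeff_coe, h1, mul_sub, map_sub, mul_comm, PowerSeries.coeff_C_mul,
    ← mul_assoc, PowerSeries.coeff_mul_X_pow', if_neg (by omega), sub_zero, hCoeff]

/-- A solution of the Bethe equations in the fermionic form: pairwise distinct numbers with product
one and a common `(N + 1 + k)`-th power. -/
structure IsBetheRoot {N : ℕ} (k : ℕ) (ξ : Fin (N + 1) → ℂ) (c : ℂ) : Prop where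
  injective : Function.Injective ξ
  prod_eq_one : ∏ i, ξ i = 1
  pow_eq : ∀ i, ξ i ^ (N + 1 + k) = c

theorem sum_inflowBound {N : ℕ} (m : Fin (N + 1) → ℕ) : ∑ j, inflowBound m j = ∑ i, m i := by
  rw [Fin.sum_univ_succ, Fin.sum_univ_castSucc m, add_comm]
  simp [inflowBound]

variable {N k : ℕ} {ξ : Fin (N + 1) → ℂ} {c : ℂ}

theorem IsBetheRoot.revPoly_mul (h : IsBetheRoot k ξ c) (m : Fin (N + 1) → ℕ)
    (hm : ∑ i, m i = k) :
    revPoly ξ * (pieriMatrix ξ (expo m) (inflowBound m)).det =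
      Polynomial.C (alternant ξ (expo m)) *
        (1 - Polynomial.C c * Polynomial.X ^ (N + 1 + k)) := by
  have h1 := revPoly_mul_det_pieriMatrix ξ c (expo m) (inflowBound m) (fun j => by
    rw [expo_castSucc]; simp [inflowBound]; omega) (fun i => by
    have h2 : expo m 0 + inflowBound m 0 + 1 = N + 1 + k := by
      have := expo_zero m
      simp only [inflowBound, Fin.cons_zero]
      omega
    rw [h2, expo_last, pow_zero, mul_one, h.pow_eq i])
  have h3 : ∑ j, (inflowBound m j + 1) = N + 1 + k := by
    rw [Finset.sum_add_distrib, sum_inflowBound, hm]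
    simp
    omega
  rw [h1, h3]

theorem IsBetheRoot.pieri (h : IsBetheRoot k ξ c) (m : Fin (N + 1) → ℕ) (hm : ∑ i, m i = k)
    {r : ℕ} (hr : r < N + 1 + k) :
    ∑ ε ∈ Finset.piAntidiag (Finset.univ : Finset (Fin (N + 1))) r with
        ∀ j, ε j ≤ inflowBound m j, alternant ξ (expo (inflow m ε)) =
      hCoeff ξ r * alternant ξ (expo m) := by
  rw [mul_comm, ← hCoeff_eq_of_mul ξ _ _ _ _ (h.revPoly_mul m hm) hr, coeff_pieriMatrix_det]
  refine Finset.sum_congr rfl fun ε hε => ?_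
  have h1 : ∀ j, ε j ≤ inflowBound m j := (Finset.mem_filter.1 hε).2
  -- The two exponent vectors differ by a constant, so the alternants differ by the factor (∏ ξ_i) ^
  -- ε_last = 1.
  have h2 : (fun j => expo m j + ε j) = fun j => expo (inflow m ε) j + ε (Fin.last N) :=
    funext fun j => (expo_inflow m ε h1 j).symm
  rw [h2, alternant, alternant]
  have h3 := Matrix.det_mul_column (fun i => ξ i ^ ε (Fin.last N))
    (Matrix.of fun i j => ξ i ^ expo (inflow m ε) j)
  rw [Finset.prod_pow, h.prod_eq_one, one_pow, one_mul] at h3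
  rw [← h3]
  congr 1
  ext i j
  simp [pow_add, mul_comm]

/-- The linear functional on states given by the alternants in `ξ`. -/
def betheFunctional (ξ : Fin (N + 1) → ℂ) : State N →ₗ[ℂ] ℂ :=
  Finsupp.linearCombination ℂ fun m => alternant ξ (expo m)

theorem betheFunctional_single (ξ : Fin (N + 1) → ℂ) (m : Fin (N + 1) → ℕ) :
    betheFunctional ξ (Finsupp.single m 1) = alternant ξ (expo m) := by
  rw [betheFunctional, Finsupp.linearCombination_single, one_smul]

theorem level_eq_span (N k : ℕ) : level N k =
    Submodule.span ℂ ((fun m => Finsupp.single m 1) '' {m : Fin (N + 1) → ℕ | ∑ i, m i = k}) :=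
  Finsupp.supported_eq_span_single ℂ _

/-- This is the eigenvector property behind the whole argument: one functional serves all h_r(a) at
once, so products of these operators multiply eigenvalues in whatever order they are taken. -/
theorem IsBetheRoot.functional_placticH (h : IsBetheRoot k ξ c) {r : ℕ} (hr : r < N + 1 + k)
    {x : State N} (hx : x ∈ level N k) :
    betheFunctional ξ (placticH N r x) = hCoeff ξ r * betheFunctional ξ x := by
  rw [level_eq_span] at hx
  induction hx using Submodule.span_induction with
  | mem x hx =>
    obtain ⟨m, hm, rfl⟩ := hx
    simp only
    rw [placticH_single, map_sum, betheFunctional_single, ← h.pieri m hm hr]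
    exact Finset.sum_congr rfl fun ε _ => betheFunctional_single _ _
  | zero => simp
  | add x y _ _ hx hy => rw [map_add, map_add, map_add, hx, hy, mul_add]
  | smul a x _ hx => rw [map_smul, map_smul, map_smul, hx, smul_eq_mul, smul_eq_mul]; ring

/-! ### The bialternant formula -/

/-- The complete symmetric function with an integer index, zero for negative indices. -/
def hInt (ξ : Fin (N + 1) → ℂ) (r : ℤ) : ℂ := if 0 ≤ r then hCoeff ξ r.toNat else 0

theorem hInt_natCast (ξ : Fin (N + 1) → ℂ) (r : ℕ) : hInt ξ r = hCoeff ξ r := by simp [hInt]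

theorem hInt_of_neg (ξ : Fin (N + 1) → ℂ) {r : ℤ} (h : r < 0) : hInt ξ r = 0 :=
  if_neg (not_le.2 h)

theorem hCoeff_zero (ξ : Fin (N + 1) → ℂ) : hCoeff ξ 0 = 1 := by
  have := congrArg PowerSeries.constantCoeff (revPoly_mul_hSeries ξ)
  rw [map_mul, constantCoeff_revPoly, one_mul, map_one] at this
  rwa [hCoeff, PowerSeries.coeff_zero_eq_constantCoeff_apply]

theorem hInt_zero (ξ : Fin (N + 1) → ℂ) : hInt ξ 0 = 1 := by
  have := hInt_natCast ξ 0
  rwa [Nat.cast_zero, hCoeff_zero] at this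

/-- The polynomial `∏ (1 - ξ_j X)` over all `j ≠ i`. -/
def revPolyErase (ξ : Fin (N + 1) → ℂ) (i : Fin (N + 1)) : Polynomial ℂ :=
  ∏ j ∈ Finset.univ.erase i, (1 - Polynomial.C (ξ j) * Polynomial.X)

theorem natDegree_one_sub_C_mul_X_le (a : ℂ) :
    (1 - Polynomial.C a * Polynomial.X).natDegree ≤ 1 := by
  compute_degree

theorem natDegree_revPolyErase_le (ξ : Fin (N + 1) → ℂ) (i : Fin (N + 1)) :
    (revPolyErase ξ i).natDegree ≤ N := by
  refine (Polynomial.natDegree_prod_le _ _).trans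
    ((Finset.sum_le_card_nsmul _ _ 1 fun j _ => natDegree_one_sub_C_mul_X_le _).trans ?_)
  simp

/-- Both sides are 1 / (1 - ξ_i X): the remaining factors of the denominator of `hSeries` are
cancelled by `revPolyErase`. -/
theorem mk_pow_eq (ξ : Fin (N + 1) → ℂ) (i : Fin (N + 1)) :
    PowerSeries.mk (fun l => ξ i ^ l) = (revPolyErase ξ i : PowerSeries ℂ) * hSeries ξ := by
  have h1 : PowerSeries.mk (fun l => ξ i ^ l) *
      ((1 - Polynomial.C (ξ i) * Polynomial.X : Polynomial ℂ) : PowerSeries ℂ) = 1 := by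
    rw [Polynomial.coe_sub, Polynomial.coe_mul, Polynomial.coe_one, Polynomial.coe_C,
      Polynomial.coe_X, mul_sub, mul_one, ← mul_assoc]
    ext l
    cases l with
    | zero => simp
    | succ l =>
      rw [map_sub, PowerSeries.coeff_succ_mul_X, mul_comm, PowerSeries.coeff_C_mul,
        PowerSeries.coeff_mk, PowerSeries.coeff_mk, PowerSeries.coeff_one]
      simp [pow_succ']
  have h2 : revPoly ξ = (1 - Polynomial.C (ξ i) * Polynomial.X) * revPolyErase ξ i :=
    (Finset.mul_prod_erase _ _ (Finset.mem_univ i)).symm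
  have h3 := revPoly_mul_hSeries ξ
  rw [h2, Polynomial.coe_mul] at h3
  calc PowerSeries.mk (fun l => ξ i ^ l) = PowerSeries.mk (fun l => ξ i ^ l) * 1 := by rw [mul_one]
    _ = _ := by rw [← h3, mul_assoc, ← mul_assoc, ← mul_assoc, h1, one_mul]

theorem pow_eq_sum_hInt (ξ : Fin (N + 1) → ℂ) (i : Fin (N + 1)) (l : ℕ) :
    ξ i ^ l = ∑ m : Fin (N + 1), hInt ξ ((l : ℤ) - (m : ℕ)) * (revPolyErase ξ i).coeff m := by
  have h1 := congrArg (PowerSeries.coeff l) (mk_pow_eq ξ i)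
  rw [PowerSeries.coeff_mk, PowerSeries.coeff_mul,
    Finset.Nat.sum_antidiagonal_eq_sum_range_succ fun a b =>
      PowerSeries.coeff a (revPolyErase ξ i : PowerSeries ℂ) * PowerSeries.coeff b (hSeries ξ)] at h1
  rw [h1, Fin.sum_univ_eq_sum_range
    (fun m => hInt ξ ((l : ℤ) - (m : ℕ)) * (revPolyErase ξ i).coeff m) (N + 1)]
  have h2 : ∀ m ∈ Finset.range (l + 1), PowerSeries.coeff m (revPolyErase ξ i : PowerSeries ℂ) *
      PowerSeries.coeff (l - m) (hSeries ξ) =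
        hInt ξ ((l : ℤ) - (m : ℕ)) * (revPolyErase ξ i).coeff m := by
    intro m hm
    have hm : m < l + 1 := Finset.mem_range.1 hm
    rw [Polynomial.coeff_coe, mul_comm, ← Nat.cast_sub (by omega), hInt_natCast, hCoeff]
  rw [Finset.sum_congr rfl h2]
  -- The convolution runs over m ≤ l and the target sum over m ≤ N. Both extend by zeros to a common
  -- range, the first because of negative indices of h, the second because of the degree bound.
  have h3 : ∀ m ∈ Finset.range (l + N + 1), m ∉ Finset.range (l + 1) →
      hInt ξ ((l : ℤ) - (m : ℕ)) * (revPolyErase ξ i).coeff m = 0 := by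
    intro m _ hm
    rw [Finset.mem_range] at hm
    rw [hInt_of_neg ξ (by omega), zero_mul]
  have h4 : ∀ m ∈ Finset.range (l + N + 1), m ∉ Finset.range (N + 1) →
      hInt ξ ((l : ℤ) - (m : ℕ)) * (revPolyErase ξ i).coeff m = 0 := by
    intro m _ hm
    rw [Finset.mem_range] at hm
    have := natDegree_revPolyErase_le ξ i
    rw [Polynomial.coeff_eq_zero_of_natDegree_lt (by omega), mul_zero]
  rw [Finset.sum_subset (Finset.range_subset_range.2 (by omega)) h3,
    Finset.sum_subset (Finset.range_subset_range.2 (by omega)) h4]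

/-- The Jacobi-Trudi matrix in the complete symmetric functions of `ξ`. -/
def jacobiTrudi {M : ℕ} (ξ : Fin (N + 1) → ℂ) (lam : Fin M → ℕ) : Matrix (Fin M) (Fin M) ℂ :=
  Matrix.of fun i j => hInt ξ ((lam i : ℤ) - ((i : ℕ) : ℤ) + ((j : ℕ) : ℤ))

/-- The expansion of ξ_i^l in the h's is a matrix factorisation whose second factor does not depend
on the partition; taking the zero partition identifies its determinant with the denominator of the
bialternant formula. -/
theorem alternant_eq_det_mul (ξ : Fin (N + 1) → ℂ) (lam : Fin (N + 1) → ℕ) :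
    alternant ξ (fun j => lam j + (N - j)) = (jacobiTrudi ξ lam).det *
      (Matrix.of fun j i : Fin (N + 1) => (revPolyErase ξ i).coeff (Fin.rev j)).det := by
  rw [alternant, ← Matrix.det_transpose, ← Matrix.det_mul]
  congr 1
  ext j i
  rw [Matrix.transpose_apply, Matrix.of_apply, Matrix.mul_apply, pow_eq_sum_hInt,
    ← Equiv.sum_comp Fin.revPerm]
  refine Finset.sum_congr rfl fun m _ => ?_
  simp only [jacobiTrudi, Matrix.of_apply, Fin.revPerm_apply]
  congr 2
  rw [Fin.val_rev]
  omega

theorem det_jacobiTrudi_zero {M : ℕ} (ξ : Fin (N + 1) → ℂ) :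
    (jacobiTrudi ξ (fun _ : Fin M => 0)).det = 1 := by
  rw [Matrix.det_of_isUpperTriangular]
  · refine Finset.prod_eq_one fun i _ => ?_
    simp [jacobiTrudi, hInt_zero]
  · intro i j hij
    have hij : j < i := hij
    rw [Fin.lt_def] at hij
    exact hInt_of_neg ξ (by push_cast; omega)

/-- The extra last row is (0, ..., 0, 1), as h vanishes at negative indices. This reconciles
alternants of size n with Jacobi-Trudi determinants of size n - 1. -/
theorem det_jacobiTrudi_snoc_zero (ξ : Fin (N + 1) → ℂ) {M : ℕ} (lam : Fin M → ℕ) :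
    (jacobiTrudi ξ (Fin.snoc lam 0 : Fin (M + 1) → ℕ)).det = (jacobiTrudi ξ lam).det := by
  rw [Matrix.det_succ_row _ (Fin.last M), Finset.sum_eq_single (Fin.last M)]
  · have h1 : jacobiTrudi ξ (Fin.snoc lam 0 : Fin (M + 1) → ℕ) (Fin.last M) (Fin.last M) = 1 := by
      simp [jacobiTrudi, hInt_zero]
    rw [h1, Fin.val_last, ← two_mul, pow_mul, neg_one_sq, one_pow, one_mul, one_mul]
    congr 1
    ext i j
    simp [jacobiTrudi]
  · intro j _ hj
    have : jacobiTrudi ξ (Fin.snoc lam 0 : Fin (M + 1) → ℕ) (Fin.last M) j = 0 := by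
      have hj' : (j : ℕ) < M := Fin.val_lt_last hj
      rw [jacobiTrudi, Matrix.of_apply, Fin.snoc_last, Fin.val_last]
      exact hInt_of_neg ξ (by push_cast; omega)
    rw [this]; ring
  · simp

theorem alternant_snoc_zero (ξ : Fin (N + 1) → ℂ) (lam : Fin N → ℕ) :
    alternant ξ (fun j => (Fin.snoc lam 0 : Fin (N + 1) → ℕ) j + (N - j)) =
      (jacobiTrudi ξ lam).det * alternant ξ (fun j => N - j) := by
  have h := alternant_eq_det_mul ξ (fun _ => 0)
  simp only [zero_add, det_jacobiTrudi_zero, one_mul] at h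
  rw [alternant_eq_det_mul, det_jacobiTrudi_snoc_zero, h]

theorem alternant_rho_ne_zero (hξ : Function.Injective ξ) : alternant ξ (fun j => N - j) ≠ 0 := by
  have h := Matrix.det_permute' Fin.revPerm (Matrix.vandermonde ξ)
  have h1 : (Matrix.vandermonde ξ).submatrix id Fin.revPerm =
      Matrix.of fun i (j : Fin (N + 1)) => ξ i ^ (N - (j : ℕ)) := by
    ext i j
    simp only [Matrix.submatrix_apply, Matrix.vandermonde_apply, Fin.revPerm_apply, Fin.val_rev,
      Matrix.of_apply, id]
    congr 1
    omega
  rw [alternant, ← h1, h]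
  refine mul_ne_zero ?_ (Matrix.det_vandermonde_ne_zero_iff.2 hξ)
  rcases Int.units_eq_one_or (Equiv.Perm.sign (Fin.revPerm : Equiv.Perm (Fin (N + 1)))) with h | h <;>
    simp [h]

theorem part_antitone (lam : BoxPartition N k) : Antitone (part lam) := by
  intro i j hij
  unfold part
  split_ifs with h1 h2
  · exact lam.2 (show (⟨i, h2⟩ : Fin N) ≤ ⟨j, h1⟩ from hij)
  · omega
  · exact Nat.zero_le _
  · exact le_rfl

theorem part_le (lam : BoxPartition N k) (i : ℕ) : part lam i ≤ k := by
  unfold part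
  split_ifs
  · exact Nat.lt_succ_iff.1 (lam.1 _).2
  · exact Nat.zero_le _

theorem expo_dynkin (lam : BoxPartition N k) (j : Fin (N + 1)) :
    expo (dynkin lam) j = part lam j + (N - j) := by
  induction j using Fin.reverseInduction with
  | last => rw [expo_last]; simp [part]
  | cast j ih =>
    have h1 : dynkin lam j.castSucc = part lam j - part lam (j + 1) := by
      simp [dynkin, (Fin.castSucc_lt_last j).ne]
    have h2 := part_antitone lam (Nat.le_succ j)
    rw [expo_castSucc, ih, h1, Fin.val_succ, Fin.val_castSucc]
    simp only [Nat.succ_eq_add_one] at h2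
    omega

/-- The Schur function of a box partition in the numbers `ξ`. -/
def schurValue (ξ : Fin (N + 1) → ℂ) (lam : BoxPartition N k) : ℂ :=
  (jacobiTrudi ξ fun i => (lam.1 i : ℕ)).det

theorem alternant_dynkin (ξ : Fin (N + 1) → ℂ) (lam : BoxPartition N k) :
    alternant ξ (expo (dynkin lam)) =
      schurValue ξ lam * alternant ξ (expo (dynkin (emptyPartition N k))) := by
  have h1 : expo (dynkin (emptyPartition N k)) = fun j : Fin (N + 1) => N - j := by
    ext j
    rw [expo_dynkin]
    simp [part, emptyPartition]
  have h2 : expo (dynkin lam) = fun j : Fin (N + 1) =>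
      (Fin.snoc (fun i => (lam.1 i : ℕ)) 0 : Fin (N + 1) → ℕ) j + (N - j) := by
    ext j
    rw [expo_dynkin]
    congr 1
  rw [h1, h2, alternant_snoc_zero, schurValue]

theorem alternant_empty_ne_zero (hξ : Function.Injective ξ) :
    alternant ξ (expo (dynkin (emptyPartition N k))) ≠ 0 := by
  have h1 : expo (dynkin (emptyPartition N k)) = fun j : Fin (N + 1) => N - j := by
    ext j
    rw [expo_dynkin]
    simp [part, emptyPartition]
  rw [h1]
  exact alternant_rho_ne_zero hξ

/-- Apply the Pieri rule to the vacuum, whose alternant is nonzero: with only k particles there is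
no way to move r > k of them, so the left side is an empty sum. -/
theorem IsBetheRoot.hCoeff_eq_zero (h : IsBetheRoot k ξ c) {r : ℕ} (hk : k < r)
    (hr : r < N + 1 + k) : hCoeff ξ r = 0 := by
  have h1 := h.pieri (dynkin (emptyPartition N k)) (sum_dynkin _) hr
  rw [Finset.filter_false_of_mem, Finset.sum_empty] at h1
  · exact (mul_eq_zero.1 h1.symm).resolve_right (alternant_empty_ne_zero h.injective)
  · intro ε hε hle
    have h2 := Finset.sum_le_sum fun j (_ : j ∈ Finset.univ) => hle j
    rw [sum_inflowBound, sum_dynkin, (Finset.mem_piAntidiag.1 hε).1] at h2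
    omega

theorem IsBetheRoot.functional_placticHInt (h : IsBetheRoot k ξ c) {r : ℤ}
    (hr : r < N + 1 + k) {x : State N} (hx : x ∈ level N k) :
    betheFunctional ξ (placticHInt N r x) = hInt ξ r * betheFunctional ξ x := by
  unfold placticHInt hInt
  split_ifs with h0
  · exact h.functional_placticH (by omega) hx
  · simp

theorem IsBetheRoot.functional_list_prod (h : IsBetheRoot k ξ c) (l : List ℤ)
    (hl : ∀ r ∈ l, r < N + 1 + k) {x : State N} (hx : x ∈ level N k) :
    (l.map (placticHInt N)).prod x ∈ level N k ∧
    betheFunctional ξ ((l.map (placticHInt N)).prod x) =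
      (l.map (hInt ξ)).prod * betheFunctional ξ x := by
  induction l with
  | nil => simpa using hx
  | cons r l ih =>
    obtain ⟨h1, h2⟩ := ih fun s hs => hl s (List.mem_cons_of_mem _ hs)
    rw [List.map_cons, List.prod_cons, Module.End.mul_apply, List.map_cons, List.prod_cons]
    constructor
    · rw [level_eq_levelInt] at h1 ⊢
      simpa using shifts_placticHInt N r _ _ h1
    · rw [h.functional_placticHInt (hl r List.mem_cons_self) h1, h2, mul_assoc]

theorem IsBetheRoot.functional_placticSchur (h : IsBetheRoot k ξ c) (lam : BoxPartition N k)
    {x : State N} (hx : x ∈ level N k) :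
    betheFunctional ξ (placticSchur lam x) = schurValue ξ lam * betheFunctional ξ x := by
  rw [placticSchur, LinearMap.sum_apply, map_sum, schurValue, ← Matrix.det_transpose,
    Matrix.det_apply', Finset.sum_mul]
  refine Finset.sum_congr rfl fun w _ => ?_
  rw [LinearMap.smul_apply, map_smul, smul_eq_mul, mul_assoc]
  congr 1
  have h1 := (h.functional_list_prod (List.ofFn fun i : Fin N =>
    (((lam.1 i : ℕ) : ℤ) - ((i : ℕ) : ℤ) + ((w i : ℕ) : ℤ))) (by
      intro r hr
      obtain ⟨i, rfl⟩ := (List.mem_ofFn' _ _).1 hr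
      -- The largest index occurring is at most k + N - 1, inside the range r < n + k where the
      -- eigenvalue is known.
      have := (lam.1 i).2
      have := (w i).2
      simp only
      omega) hx).2
  rw [List.map_ofFn, List.map_ofFn, List.prod_ofFn (f := hInt ξ ∘ _)] at h1
  exact h1

/-! ### The generating polynomial of the eigenvalues -/

/-- The polynomial `∑_{r ≤ k} h_r(ξ) X^r`. -/
def hTrunc (k : ℕ) (ξ : Fin (N + 1) → ℂ) : Polynomial ℂ :=
  ∑ r ∈ Finset.range (k + 1), Polynomial.C (hCoeff ξ r) * Polynomial.X ^ r

theorem hTrunc_coeff (k : ℕ) (ξ : Fin (N + 1) → ℂ) (r : ℕ) :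
    (hTrunc k ξ).coeff r = if r ≤ k then hCoeff ξ r else 0 := by
  simp [hTrunc, Polynomial.finsetSum_coeff, Polynomial.coeff_C_mul, Polynomial.coeff_X_pow]

theorem hTrunc_ne_zero (k : ℕ) (ξ : Fin (N + 1) → ℂ) : hTrunc k ξ ≠ 0 := by
  intro h
  have := hTrunc_coeff k ξ 0
  simp [h, hCoeff_zero] at this

theorem natDegree_hTrunc_le (k : ℕ) (ξ : Fin (N + 1) → ℂ) : (hTrunc k ξ).natDegree ≤ k := by
  refine Polynomial.natDegree_le_iff_coeff_eq_zero.2 fun r hr => ?_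
  rw [hTrunc_coeff, if_neg (by omega)]

/-- For the vacuum the generating polynomial of the Pieri rule has no terms above degree k, so it is
the alternant times `hTrunc k ξ`. The n numbers ξ_i and the reciprocals of the roots of `hTrunc k ξ`
together exhaust the (n + k)-th roots of c, which is the exchange of rank and level. -/
theorem IsBetheRoot.revPoly_mul_hTrunc (h : IsBetheRoot k ξ c) :
    revPoly ξ * hTrunc k ξ = 1 - Polynomial.C c * Polynomial.X ^ (N + 1 + k) := by
  set m : Fin (N + 1) → ℕ := dynkin (emptyPartition N k) with hm
  have h1 := h.revPoly_mul m (sum_dynkin _)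
  have ha : alternant ξ (expo m) ≠ 0 := alternant_empty_ne_zero h.injective
  have h2 : (pieriMatrix ξ (expo m) (inflowBound m)).det =
      Polynomial.C (alternant ξ (expo m)) * hTrunc k ξ := by
    ext r
    rw [Polynomial.coeff_C_mul, hTrunc_coeff]
    split_ifs with hr
    · exact hCoeff_eq_of_mul ξ _ _ _ _ h1 (by omega)
    · rw [coeff_pieriMatrix_det, mul_zero, Finset.filter_false_of_mem, Finset.sum_empty]
      intro ε hε hle
      have h2 := Finset.sum_le_sum fun j (_ : j ∈ Finset.univ) => hle j
      rw [sum_inflowBound, sum_dynkin, (Finset.mem_piAntidiag.1 hε).1] at h2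
      omega
  rw [h2, mul_left_comm] at h1
  exact mul_left_cancel₀ (by simpa using ha) h1

theorem natDegree_revPoly_le (ξ : Fin (N + 1) → ℂ) : (revPoly ξ).natDegree ≤ N + 1 := by
  refine (Polynomial.natDegree_prod_le _ _).trans
    ((Finset.sum_le_card_nsmul _ _ 1 fun j _ => natDegree_one_sub_C_mul_X_le _).trans ?_)
  simp

theorem revPoly_coeff_top (ξ : Fin (N + 1) → ℂ) :
    (revPoly ξ).coeff (N + 1) = (-1) ^ (N + 1) * ∏ i, ξ i := by
  have h := Polynomial.coeff_prod_of_natDegree_le (Finset.univ : Finset (Fin (N + 1)))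
    (fun i => 1 - Polynomial.C (ξ i) * Polynomial.X) 1
    (fun i _ => natDegree_one_sub_C_mul_X_le _)
  simp only [Finset.card_univ, Fintype.card_fin, mul_one] at h
  rw [revPoly, h]
  simp [Polynomial.coeff_one, Finset.prod_neg]

theorem IsBetheRoot.ne_zero (h : IsBetheRoot k ξ c) (i : Fin (N + 1)) : ξ i ≠ 0 := by
  intro h0
  have := h.prod_eq_one
  rw [Finset.prod_eq_zero (Finset.mem_univ i) h0] at this
  exact zero_ne_one this

theorem IsBetheRoot.eq_coeff (h : IsBetheRoot k ξ c) : c = (-1) ^ N * hCoeff ξ k := by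
  have h1 := congrArg (fun p => Polynomial.coeff p (N + 1 + k)) h.revPoly_mul_hTrunc
  rw [Polynomial.coeff_mul_add_eq_of_natDegree_le (natDegree_revPoly_le ξ) (natDegree_hTrunc_le k ξ),
    revPoly_coeff_top, h.prod_eq_one, hTrunc_coeff, if_pos le_rfl] at h1
  have h2 : N + 1 + k ≠ 0 := by omega
  simp [Polynomial.coeff_one] at h1
  rw [pow_succ] at h1
  linear_combination h1

/-- The top coefficient of `hTrunc` determines c, and cancelling `hTrunc` in the factorisation of 1
- c X^{n+k} then determines `revPoly`, hence the set of the ξ_i. -/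
theorem IsBetheRoot.exists_eq_of_hTrunc_eq {ξ' : Fin (N + 1) → ℂ} {c' : ℂ}
    (h : IsBetheRoot k ξ c) (h' : IsBetheRoot k ξ' c')
    (he : hTrunc k ξ = hTrunc k ξ') (i : Fin (N + 1)) : ∃ j, ξ i = ξ' j := by
  have hk : hCoeff ξ k = hCoeff ξ' k := by
    have := congrArg (fun p => Polynomial.coeff p k) he
    simpa [hTrunc_coeff] using this
  have hc : c = c' := by rw [h.eq_coeff, h'.eq_coeff, hk]
  have hr : revPoly ξ = revPoly ξ' := by
    have h1 := h.revPoly_mul_hTrunc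
    rw [hc, ← h'.revPoly_mul_hTrunc, he] at h1
    exact mul_right_cancel₀ (hTrunc_ne_zero k ξ') h1
  have h2 : (revPoly ξ).eval (ξ i)⁻¹ = 0 := by
    rw [revPoly, Polynomial.eval_prod]
    refine Finset.prod_eq_zero (Finset.mem_univ i) ?_
    simp [h.ne_zero i]
  rw [hr, revPoly, Polynomial.eval_prod, Finset.prod_eq_zero_iff] at h2
  obtain ⟨j, -, hj⟩ := h2
  refine ⟨j, ?_⟩
  simp only [Polynomial.eval_sub, Polynomial.eval_one, Polynomial.eval_mul, Polynomial.eval_C,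
    Polynomial.eval_X] at hj
  have := h.ne_zero i
  field_simp at hj
  linear_combination hj

/-! ### The solutions attached to partitions -/

theorem sum_part (lam : BoxPartition N k) :
    ∑ i : Fin (N + 1), (part lam i : ℝ) = ∑ j : Fin N, ((lam.1 j : ℕ) : ℝ) := by
  rw [Fin.sum_univ_castSucc]
  simp [part]

theorem sum_half_sub (N : ℕ) : ∑ i : Fin (N + 1), ((N : ℝ) / 2 - ((i : ℕ) : ℝ)) = 0 := by
  have h := Finset.sum_range_id_mul_two (N + 1)
  rw [Nat.add_sub_cancel] at h
  rw [Finset.sum_sub_distrib, Fin.sum_univ_eq_sum_range (fun i => (i : ℝ)) (N + 1)]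
  have h' : (∑ i ∈ Finset.range (N + 1), (i : ℝ)) * 2 = (N + 1) * N := by
    have := congrArg (Nat.cast : ℕ → ℝ) h
    push_cast at this
    exact this
  simp
  linarith

theorem sum_shiftedWeight (lam : BoxPartition N k) : ∑ i, shiftedWeight lam i = 0 := by
  unfold shiftedWeight
  rw [Finset.sum_add_distrib, sum_half_sub, Finset.sum_sub_distrib, sum_part]
  have : (N : ℝ) + 1 ≠ 0 := by positivity
  simp
  field_simp
  ring

/-- The common fractional part of the shifted weight. -/
def weightOffset (lam : BoxPartition N k) : ℝ :=
  (N : ℝ) / 2 - (∑ j : Fin N, ((lam.1 j : ℕ) : ℝ)) / ((N : ℝ) + 1)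

theorem shiftedWeight_eq (lam : BoxPartition N k) (i : Fin (N + 1)) :
    shiftedWeight lam i = (((part lam i : ℤ) - (i : ℕ) : ℤ) : ℝ) + weightOffset lam := by
  unfold shiftedWeight weightOffset
  push_cast
  ring

theorem shiftedWeight_strictAnti (lam : BoxPartition N k) : StrictAnti (shiftedWeight lam) := by
  intro i j hij
  rw [shiftedWeight_eq, shiftedWeight_eq, add_lt_add_iff_right, Int.cast_lt]
  have := part_antitone lam hij.le
  rw [Fin.lt_def] at hij
  omega

theorem shiftedWeight_sub_lt (lam : BoxPartition N k) (i j : Fin (N + 1)) :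
    shiftedWeight lam i - shiftedWeight lam j < ((N + 1 + k : ℕ) : ℝ) := by
  rw [shiftedWeight_eq, shiftedWeight_eq, add_sub_add_right_eq_sub, ← Int.cast_sub]
  have h1 := part_le lam i
  have h2 := j.2
  have h3 : ((part lam i : ℤ) - (i : ℕ)) - ((part lam j : ℤ) - (j : ℕ)) < ((N + 1 + k : ℕ) : ℤ) := by
    omega
  exact_mod_cast h3

/-- The Bethe root `ξ_i = exp (-2πi (σ + ρ)_i / (k + n))` attached to a partition `σ`. -/
def bethePoint (sig : BoxPartition N k) (i : Fin (N + 1)) : ℂ :=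
  Complex.exp (-(2 * Real.pi * Complex.I / ((k : ℂ) + (N : ℂ) + 1)) * (shiftedWeight sig i : ℝ))

theorem bethePoint_eq_iff (sig tau : BoxPartition N k) (i j : Fin (N + 1)) :
    bethePoint sig i = bethePoint tau j ↔ ∃ z : ℤ,
      shiftedWeight sig i = shiftedWeight tau j + ((N + 1 + k : ℕ) : ℝ) * z := by
  have hK : ((k : ℂ) + N + 1) ≠ 0 := by exact_mod_cast (by omega : k + N + 1 ≠ 0)
  have hpi : (2 * (Real.pi : ℂ) * Complex.I) ≠ 0 := Complex.two_pi_I_ne_zero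
  rw [bethePoint, bethePoint, Complex.exp_eq_exp_iff_exists_int]
  constructor
  · rintro ⟨z, hz⟩
    refine ⟨-z, ?_⟩
    have h1 : (2 * (Real.pi : ℂ) * Complex.I) * (shiftedWeight sig i : ℂ) =
        (2 * (Real.pi : ℂ) * Complex.I) *
          ((shiftedWeight tau j : ℂ) + ((k : ℂ) + N + 1) * (-z)) := by
      field_simp at hz
      linear_combination (-2 * (Real.pi : ℂ) * Complex.I) * hz
    have h2 := mul_left_cancel₀ hpi h1
    have h3 : ((shiftedWeight sig i : ℝ) : ℂ) =
        ((shiftedWeight tau j + ((N + 1 + k : ℕ) : ℝ) * ((-z : ℤ) : ℝ) : ℝ) : ℂ) := by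
      rw [h2]; push_cast; ring
    exact_mod_cast h3
  · rintro ⟨z, hz⟩
    refine ⟨-z, ?_⟩
    rw [hz]
    push_cast
    field_simp
    ring

/-- The coordinates of σ + ρ sum to zero, which gives product one; they strictly decrease with
spread less than n + k, which gives distinctness; and they agree modulo 1, which gives the common
power. -/
theorem isBetheRoot_bethePoint (sig : BoxPartition N k) :
    IsBetheRoot k (bethePoint sig)
      (Complex.exp (-(2 * Real.pi * Complex.I * (weightOffset sig : ℝ)))) where
  injective := by
    intro i j hij
    obtain ⟨z, hz⟩ := (bethePoint_eq_iff sig sig i j).1 hij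
    have h1 := shiftedWeight_sub_lt sig i j
    have h2 := shiftedWeight_sub_lt sig j i
    have hK : (0 : ℝ) < ((N + 1 + k : ℕ) : ℝ) := by positivity
    have h3 : ((N + 1 + k : ℕ) : ℝ) * z < ((N + 1 + k : ℕ) : ℝ) * 1 := by linarith
    have h4 : ((N + 1 + k : ℕ) : ℝ) * (-1) < ((N + 1 + k : ℕ) : ℝ) * z := by linarith
    have h5 : z < 1 := by exact_mod_cast lt_of_mul_lt_mul_left h3 hK.le
    have h6 : -1 < z := by exact_mod_cast lt_of_mul_lt_mul_left h4 hK.le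
    have h7 : z = 0 := by omega
    rw [h7] at hz
    exact (shiftedWeight_strictAnti sig).injective (by simpa using hz)
  prod_eq_one := by
    unfold bethePoint
    rw [← Complex.exp_sum, ← Finset.mul_sum, ← Complex.ofReal_sum, sum_shiftedWeight]
    simp
  pow_eq i := by
    have hK : ((k : ℂ) + N + 1) ≠ 0 := by exact_mod_cast (by omega : k + N + 1 ≠ 0)
    rw [bethePoint, ← Complex.exp_nat_mul, Complex.exp_eq_exp_iff_exists_int]
    refine ⟨-((part sig i : ℤ) - (i : ℕ)), ?_⟩
    rw [shiftedWeight_eq]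
    push_cast
    field_simp
    ring

/-- In Lie-theoretic terms, each σ + ρ lies in the interior of the fundamental alcove, which meets
each affine Weyl orbit at most once. Concretely, equality of the point sets gives a permutation and
integer translations z with sum zero; the spread bounds force z i - z j < 2, so z cannot take both
signs and must vanish. -/
theorem eq_of_forall_bethePoint_mem (sig tau : BoxPartition N k)
    (h : ∀ i, ∃ j, bethePoint sig i = bethePoint tau j) : sig = tau := by
  choose p hp using h
  choose z hz using fun i => (bethePoint_eq_iff sig tau i (p i)).1 (hp i)
  have hK : (0 : ℝ) < ((N + 1 + k : ℕ) : ℝ) := by positivity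
  have hinj : Function.Injective p := fun i j hij =>
    (isBetheRoot_bethePoint sig).injective (by rw [hp i, hp j, hij])
  have hbij := Finite.injective_iff_bijective.1 hinj
  have hsum : ∑ i, z i = 0 := by
    have h1 : ∑ i, shiftedWeight sig i =
        ∑ i, (shiftedWeight tau (p i) + ((N + 1 + k : ℕ) : ℝ) * z i) :=
      Finset.sum_congr rfl fun i _ => hz i
    rw [Finset.sum_add_distrib, hbij.sum_comp (shiftedWeight tau), sum_shiftedWeight,
      sum_shiftedWeight, ← Finset.mul_sum, zero_add] at h1
    have h2 := (mul_eq_zero.1 h1.symm).resolve_left hK.ne'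
    exact_mod_cast h2
  have hdiff : ∀ i j, z i - z j < 2 := by
    intro i j
    have h1 := shiftedWeight_sub_lt sig i j
    have h2 := shiftedWeight_sub_lt tau (p j) (p i)
    have h3 : ((N + 1 + k : ℕ) : ℝ) * ((z i : ℝ) - z j) < ((N + 1 + k : ℕ) : ℝ) * 2 := by
      rw [hz i, hz j] at h1
      linarith
    exact_mod_cast lt_of_mul_lt_mul_left h3 hK.le
  have hz0 : ∀ i, z i = 0 := by
    by_contra! hne
    obtain ⟨i, hi⟩ := hne
    have hpos : ∃ a, 0 < z a := by
      by_contra! hle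
      exact hi ((Finset.sum_eq_zero_iff_of_nonpos fun a _ => hle a).1 hsum i (Finset.mem_univ i))
    have hneg : ∃ a, z a < 0 := by
      by_contra! hle
      exact hi ((Finset.sum_eq_zero_iff_of_nonneg fun a _ => hle a).1 hsum i (Finset.mem_univ i))
    obtain ⟨a, ha⟩ := hpos
    obtain ⟨b, hb⟩ := hneg
    have := hdiff a b
    omega
  have hw : ∀ i, shiftedWeight sig i = shiftedWeight tau (p i) := fun i => by
    rw [hz i, hz0 i]; simp
  -- Two strictly decreasing sequences with the same range coincide; the signs make them increasing.
  have hr : Set.range (fun i => -shiftedWeight sig i) = Set.range fun i => -shiftedWeight tau i := by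
    have : (fun i => -shiftedWeight sig i) = (fun i => -shiftedWeight tau i) ∘ p :=
      funext fun i => by simp [hw i]
    rw [this, hbij.surjective.range_comp]
  have heq := (StrictMono.range_inj (shiftedWeight_strictAnti sig).neg
    (shiftedWeight_strictAnti tau).neg).1 hr
  have hs : ∀ i, shiftedWeight sig i = shiftedWeight tau i := fun i =>
    neg_injective (congrFun heq i)
  -- Since λ_n = 0, the last coordinate isolates the common offset |λ| / n, after which the parts
  -- can be compared directly.
  have hl := hs (Fin.last N)
  rw [shiftedWeight_eq, shiftedWeight_eq] at hl
  have hoff : weightOffset sig = weightOffset tau := by simpa [part] using hl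
  refine Subtype.ext (funext fun i => Fin.ext ?_)
  have hi := hs i.castSucc
  rw [shiftedWeight_eq, shiftedWeight_eq, hoff] at hi
  have hi' := add_right_cancel hi
  rw [Int.cast_inj] at hi'
  simpa [part] using hi'

theorem eq_of_hTrunc_bethePoint_eq {sig tau : BoxPartition N k}
    (h : hTrunc k (bethePoint sig) = hTrunc k (bethePoint tau)) : sig = tau :=
  eq_of_forall_bethePoint_mem sig tau fun i =>
    (isBetheRoot_bethePoint sig).exists_eq_of_hTrunc_eq (isBetheRoot_bethePoint tau) h i

/-! ### Completeness of the Bethe vectors and the modular S-matrix -/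

theorem dynkin_surjective (m : Fin (N + 1) → ℕ) (hm : ∑ i, m i = k) :
    ∃ lam : BoxPartition N k, dynkin lam = m := by
  -- The partition is recovered as the tail sums of the labels, the affine label being omitted.
  set ps : ℕ → ℕ := fun a =>
    ∑ j ∈ Finset.univ.filter (fun j : Fin N => a ≤ (j : ℕ)), m j.castSucc with hps
  have h0 : ps 0 + m (Fin.last N) = k := by
    rw [← hm, Fin.sum_univ_castSucc, hps]
    simp
  have hanti : Antitone ps := fun a b hab => Finset.sum_le_sum_of_subset fun j hj => by
    simp only [Finset.mem_filter, Finset.mem_univ, true_and] at hj ⊢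
    omega
  have hlt : ∀ a, ps a < k + 1 := fun a => by
    have := hanti (Nat.zero_le a)
    omega
  have hstep : ∀ j : Fin N, ps j = m j.castSucc + ps (j + 1) := by
    intro j
    have : (Finset.univ.filter fun i : Fin N => (j : ℕ) ≤ i) =
        insert j (Finset.univ.filter fun i : Fin N => (j : ℕ) + 1 ≤ i) := by
      ext i
      simp only [Finset.mem_filter, Finset.mem_univ, true_and, Finset.mem_insert, Fin.ext_iff]
      omega
    simp only [hps]
    rw [this, Finset.sum_insert (by simp)]
  refine ⟨⟨fun i => ⟨ps i, hlt _⟩, fun i j hij => hanti hij⟩, ?_⟩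
  have hpart : ∀ a, part (⟨fun i => ⟨ps i, hlt _⟩, fun i j hij => hanti hij⟩ :
      BoxPartition N k) a = ps a := by
    intro a
    unfold part
    split_ifs with h
    · rfl
    · refine (Finset.sum_eq_zero fun j hj => ?_).symm
      have := (Finset.mem_filter.1 hj).2
      omega
  ext i
  refine Fin.lastCases ?_ (fun i => ?_) i
  · rw [dynkin, if_pos rfl, hpart]
    omega
  · rw [dynkin, if_neg (Fin.castSucc_lt_last i).ne, hpart, hpart, Fin.val_castSucc, hstep i]
    omega

theorem span_weightVec (N k : ℕ) :
    Submodule.span ℂ (Set.range (weightVec (N := N) (k := k))) = ⊤ := by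
  have h : Submodule.map (level N k).subtype
      (Submodule.span ℂ (Set.range (weightVec (N := N) (k := k)))) = level N k := by
    rw [Submodule.map_span, ← Set.range_comp]
    conv_rhs => rw [level_eq_span]
    congr 1
    ext x
    constructor
    · rintro ⟨lam, rfl⟩
      exact ⟨dynkin lam, sum_dynkin lam, rfl⟩
    · rintro ⟨m, hm, rfl⟩
      obtain ⟨lam, rfl⟩ := dynkin_surjective m hm
      exact ⟨lam, rfl⟩
  apply Submodule.map_injective_of_injective (level N k).injective_subtype
  rw [h, Submodule.map_top, Submodule.range_subtype]

/-- The Bethe functional on the states of level `k`. -/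
def betheDual (k : ℕ) (ξ : Fin (N + 1) → ℂ) : Module.Dual ℂ (level N k) :=
  (betheFunctional ξ).domRestrict (level N k)

theorem betheDual_weightVec (ξ : Fin (N + 1) → ℂ) (lam : BoxPartition N k) :
    betheDual k ξ (weightVec lam) = alternant ξ (expo (dynkin lam)) :=
  betheFunctional_single ξ _

/-- The values of a functional on the weight basis. -/
def weightEval (N k : ℕ) : Module.Dual ℂ (level N k) →ₗ[ℂ] (BoxPartition N k → ℂ) :=
  LinearMap.pi fun lam => LinearMap.applyₗ (weightVec lam)

theorem ker_weightEval (N k : ℕ) : LinearMap.ker (weightEval N k) = ⊥ := by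
  refine LinearMap.ker_eq_bot'.2 fun f hf => ?_
  refine LinearMap.ext_on_range (span_weightVec N k) fun lam => ?_
  exact congrFun hf lam

theorem placticH_mem_level (r : ℕ) : ∀ x ∈ level N k, placticH N r x ∈ level N k := by
  intro x hx
  rw [level_eq_levelInt] at hx ⊢
  simpa using shifts_placticH N r _ x hx

/-- The generating function `∑_{r ≤ k} t ^ r h_r(a)` on states of level `k`. -/
def transferMatrix (N k : ℕ) (t : ℂ) : Module.End ℂ (level N k) :=
  ∑ r ∈ Finset.range (k + 1), t ^ r • (placticH N r).restrict (placticH_mem_level r)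

theorem IsBetheRoot.hasEigenvector (h : IsBetheRoot k ξ c) (t : ℂ) :
    Module.End.HasEigenvector (transferMatrix N k t).dualMap ((hTrunc k ξ).eval t)
      (betheDual k ξ) := by
  constructor
  · rw [Module.End.mem_eigenspace_iff]
    ext1 x
    have h1 : ∀ r ∈ Finset.range (k + 1), betheDual k ξ
        ((placticH N r).restrict (placticH_mem_level (k := k) r) x) =
          hCoeff ξ r * betheDual k ξ x := fun r hr =>
      h.functional_placticH (by have := Finset.mem_range.1 hr; omega) x.2
    rw [LinearMap.dualMap_apply, transferMatrix, LinearMap.sum_apply, map_sum, LinearMap.smul_apply,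
      hTrunc, Polynomial.eval_finsetSum, smul_eq_mul, Finset.sum_mul]
    refine Finset.sum_congr rfl fun r hr => ?_
    rw [LinearMap.smul_apply, map_smul, h1 r hr]
    simp
    ring
  · intro h0
    have h1 := betheDual_weightVec ξ (emptyPartition N k)
    rw [h0, LinearMap.zero_apply] at h1
    exact alternant_empty_ne_zero h.injective h1.symm

/-- The product of all differences is a nonzero polynomial over an infinite field. A single value of
t thus turns the family of operators h_r(a), r ≤ k, into one operator that separates the given
eigenvectors. -/
theorem exists_injective_eval {ι : Type*} [Finite ι] (p : ι → Polynomial ℂ)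
    (hp : Function.Injective p) : ∃ t : ℂ, Function.Injective fun i => (p i).eval t := by
  classical
  have := Fintype.ofFinite ι
  by_contra! hne
  have h0 : ∏ x ∈ (Finset.univ : Finset ι).offDiag, (p x.1 - p x.2) = 0 := by
    refine Polynomial.funext fun t => ?_
    obtain ⟨i, j, hij, hne⟩ := Function.not_injective_iff.1 (hne t)
    rw [Polynomial.eval_prod, Polynomial.eval_zero]
    exact Finset.prod_eq_zero (i := (i, j)) (by simpa using hne) (by simpa [sub_eq_zero] using hij)
  obtain ⟨x, hx, hx0⟩ := Finset.prod_eq_zero_iff.1 h0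
  exact (Finset.mem_offDiag.1 hx).2.2 (hp (sub_eq_zero.1 hx0))

theorem linearIndependent_betheDual {ι : Type*} [Finite ι] (ξ : ι → Fin (N + 1) → ℂ)
    (hξ : ∀ i, ∃ c, IsBetheRoot k (ξ i) c) (hinj : Function.Injective fun i => hTrunc k (ξ i)) :
    LinearIndependent ℂ fun i => weightEval N k (betheDual k (ξ i)) := by
  obtain ⟨t, ht⟩ := exists_injective_eval _ hinj
  refine LinearIndependent.map' ?_ _ (ker_weightEval N k)
  refine Module.End.eigenvectors_linearIndependent' (transferMatrix N k t).dualMap _ ht _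
    fun i => ?_
  obtain ⟨c, hc⟩ := hξ i
  exact hc.hasEigenvector t

/-- Completeness by counting: a further solution, adjoined to those of the box partitions as the
element `none`, would give more independent functionals than there are basis states. -/
theorem IsBetheRoot.exists_hTrunc_eq (h : IsBetheRoot k ξ c) :
    ∃ sig : BoxPartition N k, hTrunc k ξ = hTrunc k (bethePoint sig) := by
  by_contra! hne
  have h1 := linearIndependent_betheDual (k := k)
    (fun i : Option (BoxPartition N k) => i.elim ξ bethePoint)
    (fun i => by
      cases i with
      | none => exact ⟨c, h⟩
      | some sig => exact ⟨_, isBetheRoot_bethePoint sig⟩)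
    (fun i j hij => by
      cases i with
      | none =>
        cases j with
        | none => rfl
        | some tau => exact absurd hij (hne tau)
      | some sig =>
        cases j with
        | none => exact absurd hij.symm (hne sig)
        | some tau => exact congrArg some (eq_of_hTrunc_bethePoint_eq hij))
  have h2 := h1.fintype_card_le_finrank
  rw [Module.finrank_fintype_fun_eq_card, Fintype.card_option] at h2
  omega

/-- The matrix of alternants evaluated at the Bethe roots. -/
def alternantMatrix (N k : ℕ) : Matrix (BoxPartition N k) (BoxPartition N k) ℂ :=
  Matrix.of fun lam sig => alternant (bethePoint sig) (expo (dynkin lam))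

theorem isUnit_alternantMatrix (N k : ℕ) : IsUnit (alternantMatrix N k) := by
  rw [← Matrix.isUnit_transpose, ← Matrix.linearIndependent_rows_iff_isUnit]
  have h := linearIndependent_betheDual (k := k) (bethePoint (N := N) (k := k))
    (fun sig => ⟨_, isBetheRoot_bethePoint sig⟩) (fun _ _ h => eq_of_hTrunc_bethePoint_eq h)
  have he : (alternantMatrix N k).transpose.row =
      fun sig => weightEval N k (betheDual k (bethePoint sig)) := by
    ext sig lam
    exact (betheDual_weightVec (bethePoint sig) lam).symm
  rw [he]
  exact h

/-- The normalisation of the modular `S`-matrix. -/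
def modularPrefactor (N k : ℕ) : ℂ :=
  Complex.exp (Complex.I * Real.pi * ((N : ℂ) + 1) * (N : ℂ) / 4) /
        (Real.sqrt (((N : ℝ) + 1) * ((k : ℝ) + (N : ℝ) + 1) ^ N) : ℂ)

theorem modularPrefactor_ne_zero (N k : ℕ) : modularPrefactor N k ≠ 0 := by
  refine div_ne_zero (Complex.exp_ne_zero _) ?_
  rw [Complex.ofReal_ne_zero]
  have : (0 : ℝ) < ((N : ℝ) + 1) * ((k : ℝ) + (N : ℝ) + 1) ^ N := by positivity
  exact (Real.sqrt_pos.2 this).ne'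

/-- The vector λ + ρ differs from the exponents of the alternant by a constant vector, which pairs
to zero with σ + ρ. The Kac-Peterson sum is then the Leibniz expansion of the alternant at the Bethe
point of σ. -/
theorem modularS_eq (N k : ℕ) : modularS N k = modularPrefactor N k • alternantMatrix N k := by
  ext lam sig
  rw [Matrix.smul_apply, smul_eq_mul, alternantMatrix, Matrix.of_apply, alternant,
    Matrix.det_apply', modularS, Matrix.of_apply, modularPrefactor]
  congr 1
  refine Finset.sum_congr rfl fun w _ => ?_
  congr 1
  have h1 : ∑ i, shiftedWeight sig i * shiftedWeight lam (w⁻¹ i) =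
      ∑ i, shiftedWeight sig i * (expo (dynkin lam) (w⁻¹ i) : ℝ) := by
    have h2 : ∀ j, shiftedWeight lam j = (expo (dynkin lam) j : ℝ) + (weightOffset lam - N) := by
      intro j
      rw [shiftedWeight_eq, expo_dynkin]
      have : (j : ℕ) ≤ N := Nat.lt_succ_iff.1 j.2
      push_cast [Nat.cast_sub this]
      ring
    simp only [h2, mul_add, Finset.sum_add_distrib]
    rw [← Finset.sum_mul, sum_shiftedWeight, zero_mul, add_zero]
  rw [h1, Complex.ofReal_sum, Finset.mul_sum, Complex.exp_sum, ← Equiv.prod_comp w]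
  refine Finset.prod_congr rfl fun i _ => ?_
  rw [← Equiv.Perm.mul_apply, inv_mul_cancel, Equiv.Perm.one_apply, Matrix.of_apply, bethePoint, ← Complex.exp_nat_mul]
  congr 1
  push_cast
  ring

/-- Replace w by its inverse. The symmetry is needed because the Verlinde formula reads the inverse
matrix at (ν, σ), whereas summing over ν against S calls for the entry (σ, ν). -/
theorem modularS_symm (N k : ℕ) : (modularS N k).transpose = modularS N k := by
  ext lam sig
  rw [Matrix.transpose_apply, modularS, Matrix.of_apply, Matrix.of_apply]
  congr 1
  rw [← Equiv.sum_comp (Equiv.inv (Equiv.Perm (Fin (N + 1))))]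
  refine Finset.sum_congr rfl fun w _ => ?_
  have h : ∑ i, shiftedWeight lam i * shiftedWeight sig (w i) =
      ∑ i, shiftedWeight sig i * shiftedWeight lam (w⁻¹ i) := by
    rw [← Equiv.sum_comp w⁻¹]
    refine Finset.sum_congr rfl fun i _ => ?_
    rw [← Equiv.Perm.mul_apply w, mul_inv_cancel, Equiv.Perm.one_apply, mul_comm]
  rw [Equiv.inv_apply, Equiv.Perm.sign_inv, inv_inv, h]

theorem isUnit_det_modularS (N k : ℕ) : IsUnit (modularS N k).det := by
  rw [modularS_eq, Matrix.det_smul]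
  exact ((modularPrefactor_ne_zero N k).isUnit.pow _).mul
    ((Matrix.isUnit_iff_isUnit_det _).1 (isUnit_alternantMatrix N k))

theorem modularS_inv_symm (N k : ℕ) (nu sig : BoxPartition N k) :
    (modularS N k)⁻¹ nu sig = (modularS N k)⁻¹ sig nu := by
  have h := Matrix.transpose_nonsing_inv (modularS N k)
  rw [modularS_symm] at h
  exact congrFun (congrFun h sig) nu

/-! ### The Verlinde formula -/

theorem modularS_apply (lam sig : BoxPartition N k) :
    modularS N k lam sig = modularPrefactor N k * betheDual k (bethePoint sig) (weightVec lam) := by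
  rw [modularS_eq, betheDual_weightVec]
  rfl

theorem modularS_apply_eq_schurValue (lam sig : BoxPartition N k) :
    modularS N k lam sig =
      schurValue (bethePoint sig) lam * modularS N k (emptyPartition N k) sig := by
  rw [modularS_apply, modularS_apply, betheDual_weightVec, betheDual_weightVec, alternant_dynkin]
  ring

theorem modularS_empty_ne_zero (sig : BoxPartition N k) :
    modularS N k (emptyPartition N k) sig ≠ 0 := by
  rw [modularS_apply, betheDual_weightVec]
  exact mul_ne_zero (modularPrefactor_ne_zero N k)
    (alternant_empty_ne_zero (isBetheRoot_bethePoint sig).injective)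

/-- The Verlinde formula is a diagonalisation: summing over ν collapses S⁻¹ S to the identity, and
the eigenvalue S_{λσ} / S_{∅σ} is the Schur value at the Bethe point of σ. -/
theorem sum_fusionCoeff_mul_modularS (lam mu sig : BoxPartition N k) :
    ∑ nu, fusionCoeff lam mu nu * modularS N k nu sig =
      schurValue (bethePoint sig) lam * modularS N k mu sig := by
  have h1 : ∀ tau, ∑ nu, (modularS N k)⁻¹ tau nu * modularS N k nu sig =
      if tau = sig then 1 else 0 := by
    intro tau
    rw [← Matrix.mul_apply, Matrix.nonsing_inv_mul _ (isUnit_det_modularS N k), Matrix.one_apply]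
  calc ∑ nu, fusionCoeff lam mu nu * modularS N k nu sig
      = ∑ tau, modularS N k lam tau * modularS N k mu tau / modularS N k (emptyPartition N k) tau *
          ∑ nu, (modularS N k)⁻¹ tau nu * modularS N k nu sig := by
        simp only [fusionCoeff, Finset.sum_mul, Finset.mul_sum]
        rw [Finset.sum_comm]
        refine Finset.sum_congr rfl fun tau _ => Finset.sum_congr rfl fun nu _ => ?_
        rw [modularS_inv_symm N k nu tau]
        ring
    _ = modularS N k lam sig * modularS N k mu sig / modularS N k (emptyPartition N k) sig := by
        simp [h1]
    _ = _ := by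
        rw [modularS_apply_eq_schurValue lam sig]
        have := modularS_empty_ne_zero sig
        field_simp

theorem sum_fusionCoeff_mul_schurValue (lam mu sig : BoxPartition N k) :
    ∑ nu, fusionCoeff lam mu nu * schurValue (bethePoint sig) nu =
      schurValue (bethePoint sig) lam * schurValue (bethePoint sig) mu := by
  refine mul_right_cancel₀ (modularS_empty_ne_zero sig) ?_
  rw [mul_assoc, ← modularS_apply_eq_schurValue, ← sum_fusionCoeff_mul_modularS, Finset.sum_mul]
  exact Finset.sum_congr rfl fun nu _ => by rw [modularS_apply_eq_schurValue nu, mul_assoc]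

/-- The Bethe functionals separate the states. -/
theorem eq_of_forall_betheDual_eq {x y : level N k}
    (h : ∀ sig : BoxPartition N k, betheDual k (bethePoint sig) x = betheDual k (bethePoint sig) y) :
    x = y := by
  have hx : ∀ z : level N k, ∃ a : BoxPartition N k → ℂ, ∑ lam, a lam • weightVec lam = z := by
    intro z
    have hz : z ∈ Submodule.span ℂ (Set.range (weightVec (N := N) (k := k))) := by
      rw [span_weightVec]; trivial
    exact (Submodule.mem_span_range_iff_exists_fun ℂ).1 hz
  have hv : ∀ (a : BoxPartition N k → ℂ) (sig : BoxPartition N k),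
      Matrix.vecMul a (alternantMatrix N k) sig =
        betheDual k (bethePoint sig) (∑ lam, a lam • weightVec lam) := by
    intro a sig
    rw [map_sum, Matrix.vecMul, dotProduct]
    refine Finset.sum_congr rfl fun lam _ => ?_
    rw [map_smul, betheDual_weightVec, smul_eq_mul]
    rfl
  obtain ⟨a, rfl⟩ := hx x
  obtain ⟨b, rfl⟩ := hx y
  have hab : a = b := by
    refine Matrix.vecMul_injective_of_isUnit (isUnit_alternantMatrix N k) (funext fun sig => ?_)
    simp only [hv, h]
  rw [hab]

theorem betheDual_placticSchurLevel (lam sig : BoxPartition N k) (x : level N k) :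
    betheDual k (bethePoint sig) (placticSchurLevel lam x) =
      schurValue (bethePoint sig) lam * betheDual k (bethePoint sig) x :=
  (isBetheRoot_bethePoint sig).functional_placticSchur lam x.2

/-- Every Bethe functional takes the same value on both sides, and these functionals separate
states. The product rule for the operators below is obtained in the same way. -/
theorem placticSchurLevel_weightVec (lam mu : BoxPartition N k) :
    placticSchurLevel lam (weightVec mu) = ∑ nu, fusionCoeff lam mu nu • weightVec nu := by
  refine eq_of_forall_betheDual_eq fun sig => ?_
  refine mul_left_cancel₀ (modularPrefactor_ne_zero N k) ?_
  rw [betheDual_placticSchurLevel, mul_left_comm, ← modularS_apply,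
    ← sum_fusionCoeff_mul_modularS, map_sum, Finset.mul_sum]
  refine Finset.sum_congr rfl fun nu _ => ?_
  rw [modularS_apply, map_smul, smul_eq_mul]
  ring

theorem placticSchurLevel_mul (lam mu : BoxPartition N k) :
    placticSchurLevel lam * placticSchurLevel mu =
      ∑ nu, fusionCoeff lam mu nu • placticSchurLevel nu := by
  refine LinearMap.ext fun x => eq_of_forall_betheDual_eq fun sig => ?_
  rw [Module.End.mul_apply, betheDual_placticSchurLevel, betheDual_placticSchurLevel, ← mul_assoc,
    ← sum_fusionCoeff_mul_schurValue, LinearMap.sum_apply, map_sum, Finset.sum_mul]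
  refine Finset.sum_congr rfl fun nu _ => ?_
  rw [LinearMap.smul_apply, map_smul, betheDual_placticSchurLevel, smul_eq_mul, mul_assoc]

/-! ### The points of the Bethe variety -/

/-- The Toeplitz determinants in the coefficients of a power series are, up to sign, the
coefficients of the inverse series. -/
theorem det_toeplitz_eq_coeff_inv {A : Type*} [CommRing A] (q : ℤ → A) (h0 : q 0 = 1)
    (hneg : ∀ r < 0, q r = 0) (F : PowerSeries A)
    (hF : PowerSeries.mk (fun r : ℕ => q r) * F = 1) (r : ℕ) :
    (Matrix.of fun i j : Fin r => q (1 - ((i : ℕ) : ℤ) + ((j : ℕ) : ℤ))).det =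
      (-1) ^ r * PowerSeries.coeff r F := by
  have hF0 : PowerSeries.coeff 0 F = 1 := by
    have h := congrArg (PowerSeries.coeff 0) hF
    rw [PowerSeries.coeff_mul] at h
    simpa [h0] using h
  cases r with
  | zero => rw [Matrix.det_fin_zero, pow_zero, hF0, one_mul]
  | succ R =>
    set M : Matrix (Fin (R + 1)) (Fin (R + 1)) A :=
      Matrix.of fun i j => q (1 - ((i : ℕ) : ℤ) + ((j : ℕ) : ℤ)) with hM
    -- The reversed coefficients of F solve the Toeplitz system up to its first entry: by the
    -- convolution identity for q and F, every row of M except row 0 annihilates v.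
    set v : Fin (R + 1) → A := fun j => PowerSeries.coeff (R - j) F with hv
    have hconv : ∀ d : ℕ, ∑ s ∈ Finset.range (d + 1), q s * PowerSeries.coeff (d - s) F =
        if d = 0 then 1 else 0 := by
      intro d
      have h := congrArg (PowerSeries.coeff d) hF
      rw [PowerSeries.coeff_mul, Finset.Nat.sum_antidiagonal_eq_sum_range_succ fun a b =>
        PowerSeries.coeff a (PowerSeries.mk fun r : ℕ => q r) * PowerSeries.coeff b F,
        PowerSeries.coeff_one] at h
      simpa only [PowerSeries.coeff_mk] using h
    have hMv : M.mulVec v = Pi.single 0 (-PowerSeries.coeff (R + 1) F) := by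
      ext i
      rw [Matrix.mulVec, dotProduct]
      simp only [hM, hv, Matrix.of_apply]
      rw [Fin.sum_univ_eq_sum_range
        (fun j : ℕ => q (1 - ((i : ℕ) : ℤ) + (j : ℤ)) * PowerSeries.coeff (R - j) F) (R + 1)]
      refine Fin.cases ?_ (fun i' => ?_) i
      · rw [Pi.single_eq_same]
        have h := hconv (R + 1)
        rw [Finset.sum_range_succ', if_neg (by omega)] at h
        simp only [Nat.cast_zero, h0, one_mul, Nat.sub_zero] at h
        rw [eq_neg_iff_add_eq_zero, ← h]
        congr 1
        refine Finset.sum_congr rfl fun j _ => ?_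
        rw [Nat.add_sub_add_right]
        congr 2
        push_cast [Fin.val_zero]
        ring
      · rw [Pi.single_eq_of_ne (Fin.succ_ne_zero i')]
        -- In this row the first i' entries have negative index and vanish; what is left is the
        -- convolution in degree d = R - i' > 0.
        obtain ⟨d, hd⟩ : ∃ d, R = (i' : ℕ) + d := ⟨R - i', by have := i'.2; omega⟩
        have hd0 : d ≠ 0 := by have := i'.2; omega
        have h := hconv d
        rw [if_neg hd0] at h
        have hs : ∀ g : ℕ → A, ∑ j ∈ Finset.range (R + 1), g j =
            ∑ j ∈ Finset.range ((i' : ℕ) + (d + 1)), g j := fun g => by congr 2; omega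
        rw [hs, Finset.sum_range_add, Finset.sum_eq_zero,
          zero_add, ← h]
        · refine Finset.sum_congr rfl fun j _ => ?_
          rw [show R - ((i' : ℕ) + j) = d - j by omega]
          congr 2
          rw [Fin.val_succ]
          push_cast
          ring
        · intro j hj
          have := Finset.mem_range.1 hj
          rw [hneg _ (by rw [Fin.val_succ]; push_cast; omega), zero_mul]
    -- Cramer's rule at the last coordinate, where v equals 1: it expresses det M through the
    -- cofactor of the lower left corner, whose minor is unitriangular.
    have hadj := congrArg (fun u => u (Fin.last R)) (congrArg M.adjugate.mulVec hMv)
    simp only [Matrix.mulVec_mulVec, Matrix.adjugate_mul, Matrix.smul_mulVec, Matrix.one_mulVec,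
      Matrix.mulVec_single, Pi.smul_apply, smul_eq_mul, MulOpposite.smul_eq_mul_unop,
      MulOpposite.unop_op] at hadj
    have hvl : v (Fin.last R) = 1 := by simp [hv, hF0]
    have hdet : (M.submatrix (Fin.succAbove 0) (Fin.last R).succAbove).det = 1 := by
      rw [Matrix.det_of_isUpperTriangular]
      · refine Finset.prod_eq_one fun i _ => ?_
        simp [hM, h0]
      · intro i j hij
        have hij : j < i := hij
        rw [Fin.lt_def] at hij
        simp only [hM, Matrix.submatrix_apply, Matrix.of_apply, Fin.succAbove_zero,
          Fin.succAbove_last, Fin.val_succ, Fin.val_castSucc]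
        exact hneg _ (by push_cast; omega)
    rw [hvl, mul_one] at hadj
    rw [hadj, Matrix.col_apply, Matrix.adjugate_fin_succ_eq_det_submatrix, hdet]
    simp [pow_succ]

theorem mem_betheVariety_iff (n : ℕ) (x : Fin k → ℂ) : x ∈ betheVariety n k ↔
    ∀ i : Fin k, MvPolynomial.aeval x (hPoly k (n + i)) = if (i : ℕ) = 0 then 1 else 0 := by
  rw [betheVariety, MvPolynomial.zeroLocus_span]
  simp only [Set.mem_ofPred_eq, Set.forall_mem_range, map_sub, sub_eq_zero]
  refine forall_congr' fun i => ?_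
  split_ifs <;> simp

/-- The elementary symmetric functions with integer index at a point of `ℂ ^ k`. -/
def eAt (x : Fin k → ℂ) (r : ℤ) : ℂ := MvPolynomial.aeval x (eVar k r)

theorem eAt_zero (x : Fin k → ℂ) : eAt x 0 = 1 := by simp [eAt, eVar]

theorem eAt_succ (x : Fin k → ℂ) (i : Fin k) : eAt x ((i : ℕ) + 1 : ℕ) = x i := by
  have h1 : (((i : ℕ) + 1 : ℕ) : ℤ) ≠ 0 := by omega
  have h2 : 1 ≤ (((i : ℕ) + 1 : ℕ) : ℤ) ∧ (((i : ℕ) + 1 : ℕ) : ℤ) ≤ k := by omega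
  rw [eAt, eVar, if_neg h1, dif_pos h2, MvPolynomial.aeval_X]
  congr 1
  ext
  simp

theorem eAt_of_neg (x : Fin k → ℂ) {r : ℤ} (h : r < 0) : eAt x r = 0 := by
  rw [eAt, eVar, if_neg (by omega), dif_neg (by omega), map_zero]

theorem eAt_of_lt (x : Fin k → ℂ) {r : ℤ} (h : k < r) : eAt x r = 0 := by
  rw [eAt, eVar, if_neg (by omega), dif_neg (by omega), map_zero]

theorem aeval_hPoly (x : Fin k → ℂ) (r : ℕ) : MvPolynomial.aeval x (hPoly k r) =
    (Matrix.of fun i j : Fin r => eAt x (1 - ((i : ℕ) : ℤ) + ((j : ℕ) : ℤ))).det := by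
  rw [hPoly, AlgHom.map_det]
  rfl

/-- The polynomial `∑ e_r X ^ r` at a point of `ℂ ^ k`. -/
def ePoly (x : Fin k → ℂ) : Polynomial ℂ :=
  ∑ r ∈ Finset.range (k + 1), Polynomial.C (eAt x r) * Polynomial.X ^ r

theorem ePoly_coeff (x : Fin k → ℂ) (r : ℕ) : (ePoly x).coeff r = eAt x r := by
  simp only [ePoly, Polynomial.finsetSum_coeff, Polynomial.coeff_C_mul, Polynomial.coeff_X_pow,
    mul_ite, mul_one, mul_zero, Finset.sum_ite_eq, Finset.mem_range]
  split_ifs with h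
  · rfl
  · exact (eAt_of_lt x (by omega)).symm

theorem natDegree_ePoly_le (x : Fin k → ℂ) : (ePoly x).natDegree ≤ k := by
  refine Polynomial.natDegree_le_iff_coeff_eq_zero.2 fun r hr => ?_
  rw [ePoly_coeff, eAt_of_lt x (by omega)]

theorem aeval_hPoly_eq_coeff (x : Fin k → ℂ) (r : ℕ) : MvPolynomial.aeval x (hPoly k r) =
    (-1) ^ r * PowerSeries.coeff r (ePoly x : PowerSeries ℂ)⁻¹ := by
  rw [aeval_hPoly]
  refine det_toeplitz_eq_coeff_inv _ (eAt_zero x) (fun r hr => eAt_of_neg x hr) _ ?_ r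
  have h : PowerSeries.mk (fun r : ℕ => eAt x r) = (ePoly x : PowerSeries ℂ) := by
    ext r
    rw [PowerSeries.coeff_mk, Polynomial.coeff_coe, ePoly_coeff]
  rw [h]
  refine PowerSeries.mul_inv_cancel _ ?_
  rw [← PowerSeries.coeff_zero_eq_constantCoeff_apply, Polynomial.coeff_coe, ePoly_coeff,
    Nat.cast_zero, eAt_zero]
  exact one_ne_zero

/-- The point of `ℂ ^ k` attached to a Bethe root. -/
def betheCoord (k : ℕ) (ξ : Fin (N + 1) → ℂ) (i : Fin k) : ℂ := hCoeff ξ (i + 1)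

theorem eAt_betheCoord (ξ : Fin (N + 1) → ℂ) {r : ℕ} (hr : r ≤ k) :
    eAt (betheCoord k ξ) r = hCoeff ξ r := by
  cases r with
  | zero => rw [Nat.cast_zero, eAt_zero, hCoeff_zero]
  | succ r => exact eAt_succ (betheCoord k ξ) ⟨r, by omega⟩

theorem ePoly_betheCoord (ξ : Fin (N + 1) → ℂ) : ePoly (betheCoord k ξ) = hTrunc k ξ := by
  ext r
  rw [ePoly_coeff, hTrunc_coeff]
  split_ifs with h
  · exact eAt_betheCoord ξ h
  · exact eAt_of_lt _ (by omega)

/-- The convention e_r = 0 for r > k matches the vanishing of h_r(ξ) for k < r < n + k. This makes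
the two Jacobi-Trudi determinants agree entry by entry. -/
theorem IsBetheRoot.eAt_eq_hInt (h : IsBetheRoot k ξ c) {r : ℤ} (hr : r < N + 1 + k) :
    eAt (betheCoord k ξ) r = hInt ξ r := by
  rcases lt_or_ge r 0 with h0 | h0
  · rw [eAt_of_neg _ h0, hInt_of_neg _ h0]
  · lift r to ℕ using h0
    rw [hInt_natCast]
    rcases le_or_gt r k with h1 | h1
    · exact eAt_betheCoord ξ h1
    · rw [eAt_of_lt _ (by omega), h.hCoeff_eq_zero h1 (by omega)]

theorem constantCoeff_ePoly_ne_zero (x : Fin k → ℂ) :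
    PowerSeries.constantCoeff (ePoly x : PowerSeries ℂ) ≠ 0 := by
  rw [← PowerSeries.coeff_zero_eq_constantCoeff_apply, Polynomial.coeff_coe, ePoly_coeff,
    Nat.cast_zero, eAt_zero]
  exact one_ne_zero

/-- The inverse of `hTrunc k ξ` agrees with ∏ (1 - ξ_i X) below degree n + k. That product has
degree at most n and coefficient (-1)^n there, which after the sign (-1)^r gives exactly the
defining equations. -/
theorem IsBetheRoot.betheCoord_mem (h : IsBetheRoot k ξ c) :
    betheCoord k ξ ∈ betheVariety (N + 1) k := by
  rw [mem_betheVariety_iff]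
  intro i
  have h1 : ∀ r < N + 1 + k, PowerSeries.coeff r (ePoly (betheCoord k ξ) : PowerSeries ℂ)⁻¹ =
      (revPoly ξ).coeff r := by
    intro r hr
    have h2 := congrArg (fun p : Polynomial ℂ => (p : PowerSeries ℂ) *
      (ePoly (betheCoord k ξ) : PowerSeries ℂ)⁻¹) h.revPoly_mul_hTrunc
    simp only [Polynomial.coe_mul, Polynomial.coe_sub, Polynomial.coe_C, Polynomial.coe_one,
      Polynomial.coe_pow, Polynomial.coe_X, ← ePoly_betheCoord] at h2
    rw [mul_assoc, PowerSeries.mul_inv_cancel _ (constantCoeff_ePoly_ne_zero _), mul_one] at h2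
    rw [← Polynomial.coeff_coe, h2, sub_mul, one_mul, map_sub, mul_comm _ (PowerSeries.X ^ _),
      mul_assoc, PowerSeries.coeff_X_pow_mul', if_neg (by omega), sub_zero]
  rw [aeval_hPoly_eq_coeff, h1 _ (by have := i.2; omega)]
  split_ifs with hi
  · rw [hi, add_zero, revPoly_coeff_top, h.prod_eq_one, mul_one, ← mul_pow]
    simp
  · have := natDegree_revPoly_le ξ
    rw [Polynomial.coeff_eq_zero_of_natDegree_lt (by omega), mul_zero]

theorem exists_fun_of_multiset {α : Type*} {n : ℕ} (s : Multiset α) (hs : Multiset.card s = n) :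
    ∃ f : Fin n → α, s = Finset.univ.val.map f := by
  subst hs
  induction s using Quotient.inductionOn with
  | h l =>
    have h : (l : Multiset α) = (Finset.univ : Finset (Fin l.length)).val.map l.get := by
      rw [Fin.univ_val_map, List.ofFn_get]
    exact ⟨l.get, h⟩

theorem exists_isBetheRoot_of_mul (P Q : Polynomial ℂ) (c : ℂ) (hP0 : P.coeff 0 = 1)
    (hPdeg : P.natDegree = N + 1) (hPtop : P.coeff (N + 1) = (-1) ^ (N + 1))
    (h : P * Q = 1 - Polynomial.C c * Polynomial.X ^ (N + 1 + k)) :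
    ∃ ξ : Fin (N + 1) → ℂ, IsBetheRoot k ξ c ∧ revPoly ξ = P := by
  have hsep : P.Separable := by
    refine Polynomial.Separable.of_mul_left (g := Q) ?_
    rw [h]
    -- For f = 1 - c X^K with K = n + k, the combination f - X f' / K equals 1, whatever c is. So f,
    -- and with it its divisor P, is separable.
    refine ⟨1, Polynomial.C ((N + 1 + k : ℕ) : ℂ)⁻¹ * -Polynomial.X, ?_⟩
    have hK : ((N + 1 + k : ℕ) : ℂ) ≠ 0 := Nat.cast_ne_zero.2 (by omega)
    have hC : Polynomial.C ((N + 1 + k : ℕ) : ℂ)⁻¹ * Polynomial.C ((N + 1 + k : ℕ) : ℂ) = 1 := by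
      rw [← Polynomial.C_mul, inv_mul_cancel₀ hK, Polynomial.C_1]
    have hX : (Polynomial.X : Polynomial ℂ) ^ (N + 1 + k) =
        Polynomial.X * Polynomial.X ^ (N + 1 + k - 1) := by
      rw [← pow_succ']; congr 1; omega
    rw [Polynomial.derivative_sub, Polynomial.derivative_one, Polynomial.derivative_C_mul_X_pow,
      hX, Polynomial.C_mul]
    linear_combination (Polynomial.C c * (Polynomial.X * Polynomial.X ^ (N + 1 + k - 1))) * hC
  have hsplit := IsAlgClosed.splits P
  obtain ⟨ρ, hρ⟩ := exists_fun_of_multiset P.roots (hsplit.natDegree_eq_card_roots ▸ hPdeg)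
  have hlead : P.leadingCoeff = (-1) ^ (N + 1) := by rw [Polynomial.leadingCoeff, hPdeg, hPtop]
  have hfac : P = Polynomial.C ((-1) ^ (N + 1)) * ∏ i, (Polynomial.X - Polynomial.C (ρ i)) := by
    have h1 := hsplit.eq_prod_roots
    rw [hlead, hρ, Multiset.map_map] at h1
    exact h1
  have hprod : ∏ i, ρ i = 1 := by
    have h1 := congrArg (Polynomial.eval 0) hfac
    rw [← Polynomial.coeff_zero_eq_eval_zero, hP0, Polynomial.eval_mul, Polynomial.eval_C,
      Polynomial.eval_prod] at h1
    simp only [Polynomial.eval_sub, Polynomial.eval_X, Polynomial.eval_C, zero_sub] at h1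
    rw [Finset.prod_neg, ← mul_assoc, Finset.card_univ, Fintype.card_fin, ← mul_pow] at h1
    simpa using h1.symm
  have hne : ∀ i, ρ i ≠ 0 := fun i h0 => by
    rw [Finset.prod_eq_zero (Finset.mem_univ i) h0] at hprod
    exact zero_ne_one hprod
  have hinj : Function.Injective ρ := by
    have h1 := Polynomial.nodup_roots hsep
    rw [hρ] at h1
    exact fun i j hij => Multiset.inj_on_of_nodup_map h1 i (Finset.mem_univ_val i) j
      (Finset.mem_univ_val j) hij
  refine ⟨fun i => (ρ i)⁻¹, ⟨inv_injective.comp hinj, by simp [hprod], fun i => ?_⟩, ?_⟩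
  · have h1 := congrArg (Polynomial.eval (ρ i)) h
    have h2 : P.eval (ρ i) = 0 := by
      rw [hfac, Polynomial.eval_mul, Polynomial.eval_prod,
        Finset.prod_eq_zero (Finset.mem_univ i) (by simp), mul_zero]
    rw [Polynomial.eval_mul, h2, zero_mul] at h1
    simp only [Polynomial.eval_sub, Polynomial.eval_one, Polynomial.eval_mul, Polynomial.eval_C,
      Polynomial.eval_pow, Polynomial.eval_X] at h1
    rw [inv_pow, inv_eq_iff_eq_inv]
    exact eq_inv_of_mul_eq_one_left (by linear_combination h1)
  · have h1 : ∀ i, (1 - Polynomial.C (ρ i)⁻¹ * Polynomial.X : Polynomial ℂ) =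
        -Polynomial.C (ρ i)⁻¹ * (Polynomial.X - Polynomial.C (ρ i)) := by
      intro i
      have : Polynomial.C (ρ i)⁻¹ * Polynomial.C (ρ i) = 1 := by
        rw [← Polynomial.C_mul, inv_mul_cancel₀ (hne i), Polynomial.C_1]
      linear_combination -this
    rw [revPoly, Finset.prod_congr rfl fun i _ => h1 i, Finset.prod_mul_distrib, hfac,
      Finset.prod_neg, ← map_prod, Finset.prod_inv_distrib, hprod]
    simp

/-- The equations say that the inverse of the polynomial of the e_r has a gap in degrees n + 1, ...,
n + k - 1. Its truncation P at degree n therefore has product 1 + O(X^{n+k}) with that polynomial,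
and the degree bound n + k leaves a single extra term. For k = 0 there is no equation to fix the
coefficient in degree n, hence the assumption `hk`. -/
theorem exists_isBetheRoot_of_mem (hk : 0 < k) {x : Fin k → ℂ} (hx : x ∈ betheVariety (N + 1) k) :
    ∃ (ξ : Fin (N + 1) → ℂ) (c : ℂ), IsBetheRoot k ξ c ∧ x = betheCoord k ξ := by
  rw [mem_betheVariety_iff] at hx
  set F : PowerSeries ℂ := (ePoly x : PowerSeries ℂ)⁻¹ with hF
  have hmul : F * (ePoly x : PowerSeries ℂ) = 1 :=
    PowerSeries.inv_mul_cancel _ (constantCoeff_ePoly_ne_zero x)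
  have hpow : ∀ r : ℕ, ((-1 : ℂ) ^ r) * (-1) ^ r = 1 := fun r => by rw [← mul_pow]; simp
  have hcoef : ∀ i : Fin k, PowerSeries.coeff (N + 1 + i) F =
      (-1) ^ (N + 1 + (i : ℕ)) * if (i : ℕ) = 0 then 1 else 0 := by
    intro i
    rw [← hx i, aeval_hPoly_eq_coeff, ← mul_assoc, hpow, one_mul]
  set P : Polynomial ℂ := PowerSeries.trunc (N + 2) F with hP
  have hPF : ∀ r < N + 1 + k, P.coeff r = PowerSeries.coeff r F := by
    intro r hr
    rw [hP, PowerSeries.coeff_trunc]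
    split_ifs with h
    · rfl
    · have := hcoef ⟨r - (N + 1), by omega⟩
      rw [if_neg (by simp only; omega), mul_zero] at this
      have e : N + 1 + (r - (N + 1)) = r := by omega
      simp only [e] at this
      exact this.symm
  have hPtop : P.coeff (N + 1) = (-1) ^ (N + 1) := by
    rw [hPF _ (by omega)]
    simpa using hcoef ⟨0, hk⟩
  have hF0 : PowerSeries.coeff 0 F = 1 := by
    have h := congrArg (PowerSeries.coeff 0) hmul
    rw [PowerSeries.coeff_mul] at h
    simpa [ePoly_coeff, eAt_zero] using h
  have hPle : P.natDegree ≤ N + 1 := Nat.lt_succ_iff.1 (PowerSeries.natDegree_trunc_lt F (N + 1))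
  have hPdeg : P.natDegree = N + 1 := by
    refine le_antisymm hPle (Polynomial.le_natDegree_of_ne_zero ?_)
    rw [hPtop]
    exact pow_ne_zero _ (by norm_num)
  have hPQ : P * ePoly x =
      1 - Polynomial.C (-(P * ePoly x).coeff (N + 1 + k)) * Polynomial.X ^ (N + 1 + k) := by
    ext r
    rw [Polynomial.coeff_sub, Polynomial.coeff_C_mul, Polynomial.coeff_X_pow]
    rcases lt_trichotomy r (N + 1 + k) with hr | hr | hr
    · rw [if_neg hr.ne, mul_zero, sub_zero, ← Polynomial.coeff_coe (1 : Polynomial ℂ),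
        Polynomial.coe_one, ← hmul, PowerSeries.coeff_mul, Polynomial.coeff_mul]
      refine Finset.sum_congr rfl fun p hp => ?_
      have := Finset.HasAntidiagonal.mem_antidiagonal.1 hp
      rw [hPF _ (by omega), Polynomial.coeff_coe]
    · rw [hr, if_pos rfl, Polynomial.coeff_one, if_neg (by omega)]
      ring
    · rw [if_neg hr.ne', Polynomial.coeff_one, if_neg (by omega), mul_zero, sub_zero]
      refine Polynomial.coeff_eq_zero_of_natDegree_lt ?_
      have h1 := Polynomial.natDegree_mul_le (p := P) (q := ePoly x)
      have h2 := natDegree_ePoly_le x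
      omega
  obtain ⟨ξ, hξ, hrev⟩ := exists_isBetheRoot_of_mul (k := k) P (ePoly x) _
    (by rw [hPF _ (by omega), hF0]) hPdeg hPtop hPQ
  refine ⟨ξ, _, hξ, funext fun i => ?_⟩
  have h1 := hCoeff_eq_of_mul ξ (ePoly x) 1 (-(P * ePoly x).coeff (N + 1 + k)) (N + 1 + k)
    (by rw [hrev, Polynomial.C_1, one_mul]; exact hPQ) (r := i + 1) (by have := i.2; omega)
  rw [one_mul, ePoly_coeff, eAt_succ] at h1
  exact h1

/-- The points of the Bethe variety are those attached to the box partitions. -/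
theorem betheVariety_eq_range (N k : ℕ) : betheVariety (N + 1) k =
    Set.range fun sig : BoxPartition N k => betheCoord k (bethePoint sig) := by
  ext x
  constructor
  · intro hx
    -- At level 0 the ambient space is a single point.
    rcases Nat.eq_zero_or_pos k with rfl | hk
    · exact ⟨emptyPartition N 0, Subsingleton.elim _ _⟩
    · obtain ⟨ξ, c, hξ, rfl⟩ := exists_isBetheRoot_of_mem hk hx
      obtain ⟨sig, hsig⟩ := hξ.exists_hTrunc_eq
      refine ⟨sig, funext fun i => ?_⟩
      have := congrArg (fun p => Polynomial.coeff p ((i : ℕ) + 1)) hsig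
      simpa [hTrunc_coeff, Nat.succ_le_iff.2 i.2, betheCoord] using this.symm
  · rintro ⟨sig, rfl⟩
    exact (isBetheRoot_bethePoint sig).betheCoord_mem

/-! ### The coordinate ring of the Bethe variety and the algebra of Schur polynomials -/

/-- Evaluation of polynomials at the points of the Bethe variety. -/
def betheEval (N k : ℕ) : MvPolynomial (Fin k) ℂ →ₐ[ℂ] (BoxPartition N k → ℂ) :=
  MvPolynomial.aeval fun i sig => betheCoord k (bethePoint sig) i

theorem betheEval_apply (p : MvPolynomial (Fin k) ℂ) (sig : BoxPartition N k) :
    betheEval N k p sig = MvPolynomial.aeval (betheCoord k (bethePoint sig)) p := by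
  have h : (Pi.evalAlgHom ℂ (fun _ : BoxPartition N k => ℂ) sig).comp (betheEval N k) =
      MvPolynomial.aeval (betheCoord k (bethePoint sig)) := by
    refine MvPolynomial.algHom_ext fun i => ?_
    simp [betheEval]
  exact congrArg (fun f : MvPolynomial (Fin k) ℂ →ₐ[ℂ] ℂ => f p) h

theorem ker_betheEval (N k : ℕ) : RingHom.ker (betheEval N k) = betheIdeal (N + 1) k := by
  ext p
  rw [RingHom.mem_ker, betheIdeal, MvPolynomial.mem_vanishingIdeal_iff, betheVariety_eq_range,
    Set.forall_mem_range, funext_iff]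
  refine forall_congr' fun sig => ?_
  rw [betheEval_apply]
  rfl

/-- The Jacobi-Trudi determinant in the elementary symmetric functions. -/
def schurE {N k : ℕ} (lam : BoxPartition N k) : MvPolynomial (Fin k) ℂ :=
  (Matrix.of fun i j : Fin N =>
    eVar k (((lam.1 i : ℕ) : ℤ) - ((i : ℕ) : ℤ) + ((j : ℕ) : ℤ))).det

theorem betheEval_schurE (lam sig : BoxPartition N k) :
    betheEval N k (schurE lam) sig = schurValue (bethePoint sig) lam := by
  rw [betheEval_apply, schurE, AlgHom.map_det, schurValue]
  congr 1
  ext i j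
  refine (isBetheRoot_bethePoint sig).eAt_eq_hInt ?_
  have := (lam.1 i).2
  have := j.2
  omega

/-- By the bialternant formula these vectors are the rows of the invertible alternant matrix with
each column divided by a nonzero number. The spanning property makes both evaluation maps into
functions on the box partitions surjective. -/
theorem span_schurValue (N k : ℕ) : Submodule.span ℂ
    (Set.range fun lam sig : BoxPartition N k => schurValue (bethePoint sig) lam) = ⊤ := by
  have h := isUnit_alternantMatrix N k
  rw [eq_top_iff]
  intro f _
  rw [Submodule.mem_span_range_iff_exists_fun]
  obtain ⟨a, ha⟩ := Matrix.vecMul_surjective_iff_isUnit.2 h fun sig =>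
    f sig * alternant (bethePoint sig) (expo (dynkin (emptyPartition N k)))
  refine ⟨a, funext fun sig => ?_⟩
  have h0 := alternant_empty_ne_zero (k := k) (isBetheRoot_bethePoint sig).injective
  refine mul_right_cancel₀ h0 ?_
  refine Eq.trans ?_ (congrFun ha sig)
  change _ = ∑ lam, a lam * alternantMatrix N k lam sig
  rw [Finset.sum_apply, Finset.sum_mul]
  refine Finset.sum_congr rfl fun lam _ => ?_
  rw [alternantMatrix, Matrix.of_apply, alternant_dynkin _ lam, Pi.smul_apply, smul_eq_mul, mul_assoc]

theorem betheEval_surjective (N k : ℕ) : Function.Surjective (betheEval N k) := by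
  have h : LinearMap.range (betheEval N k).toLinearMap = ⊤ := by
    rw [eq_top_iff, ← span_schurValue, Submodule.span_le]
    rintro _ ⟨lam, rfl⟩
    exact ⟨schurE lam, funext fun sig => betheEval_schurE lam sig⟩
  exact LinearMap.range_eq_top.1 h

/-- Having the Bethe functionals as left eigenvectors holds for the generators and passes to
scalars, sums and products. -/
theorem exists_eigenvalues (f : placticSchurAlgebra N k) : ∃ a : BoxPartition N k → ℂ,
    ∀ sig x, betheDual k (bethePoint sig) (f.1 x) = a sig * betheDual k (bethePoint sig) x := by
  obtain ⟨f, hf⟩ := f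
  induction hf using Algebra.adjoin_induction with
  | mem f hf =>
    obtain ⟨lam, rfl⟩ := hf
    exact ⟨fun sig => schurValue (bethePoint sig) lam, fun sig x =>
      betheDual_placticSchurLevel lam sig x⟩
  | algebraMap r =>
    refine ⟨fun _ => r, fun sig x => ?_⟩
    simp [Module.algebraMap_end_apply]
  | add f g _ _ hf hg =>
    obtain ⟨a, ha⟩ := hf
    obtain ⟨b, hb⟩ := hg
    refine ⟨a + b, fun sig x => ?_⟩
    simp only at ha hb ⊢
    rw [LinearMap.add_apply, map_add, ha, hb, Pi.add_apply, add_mul]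
  | mul f g _ _ hf hg =>
    obtain ⟨a, ha⟩ := hf
    obtain ⟨b, hb⟩ := hg
    refine ⟨a * b, fun sig x => ?_⟩
    simp only at ha hb ⊢
    rw [Module.End.mul_apply, ha, hb, Pi.mul_apply, mul_assoc]

theorem betheDual_emptyPartition_ne_zero (sig : BoxPartition N k) :
    betheDual k (bethePoint sig) (weightVec (emptyPartition N k)) ≠ 0 := by
  rw [betheDual_weightVec]
  exact alternant_empty_ne_zero (isBetheRoot_bethePoint sig).injective

/-- The joint spectrum of the algebra of affine plactic Schur polynomials. -/
def spectrumEval (N k : ℕ) : placticSchurAlgebra N k →ₐ[ℂ] (BoxPartition N k → ℂ) :=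
  -- Every Bethe functional is nonzero on the vacuum, so the chosen eigenvalues are unique and
  -- therefore compatible with the algebra operations.
  have huniq : ∀ {a b : BoxPartition N k → ℂ} (_ : ∀ sig x, a sig *
      betheDual k (bethePoint sig) x = b sig * betheDual k (bethePoint sig) x), a = b :=
    fun h => funext fun sig => mul_right_cancel₀ (betheDual_emptyPartition_ne_zero sig) (h sig _)
  AlgHom.ofLinearMap
    { toFun := fun f => (exists_eigenvalues f).choose
      map_add' := fun f g => huniq fun sig x => by
        rw [← (exists_eigenvalues (f + g)).choose_spec, Pi.add_apply, add_mul,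
          ← (exists_eigenvalues f).choose_spec, ← (exists_eigenvalues g).choose_spec, ← map_add]
        rfl
      map_smul' := fun r f => huniq fun sig x => by
        rw [← (exists_eigenvalues (r • f)).choose_spec, RingHom.id_apply, Pi.smul_apply,
          smul_eq_mul, mul_assoc, ← (exists_eigenvalues f).choose_spec, ← smul_eq_mul, ← map_smul]
        rfl }
    (huniq fun sig x => by
      simp only [LinearMap.coe_mk, AddHom.coe_mk]
      rw [← (exists_eigenvalues 1).choose_spec, Pi.one_apply, one_mul]
      rfl)
    (fun f g => huniq fun sig x => by
      simp only [LinearMap.coe_mk, AddHom.coe_mk]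
      rw [← (exists_eigenvalues (f * g)).choose_spec, Pi.mul_apply, mul_assoc,
        ← (exists_eigenvalues g).choose_spec, ← (exists_eigenvalues f).choose_spec]
      rfl)

theorem spectrumEval_spec (f : placticSchurAlgebra N k) (sig : BoxPartition N k) (x : level N k) :
    betheDual k (bethePoint sig) (f.1 x) =
      spectrumEval N k f sig * betheDual k (bethePoint sig) x :=
  (exists_eigenvalues f).choose_spec sig x

theorem spectrumEval_placticSchurGen (lam sig : BoxPartition N k) :
    spectrumEval N k (placticSchurGen lam) sig = schurValue (bethePoint sig) lam := by
  refine mul_right_cancel₀ (betheDual_emptyPartition_ne_zero sig) ?_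
  rw [← spectrumEval_spec, ← betheDual_placticSchurLevel]
  rfl

/-- Injectivity holds because the Bethe functionals separate states, surjectivity because the Schur
values already span all functions. -/
theorem spectrumEval_bijective (N k : ℕ) : Function.Bijective (spectrumEval N k) := by
  constructor
  · intro f g hfg
    refine Subtype.ext (LinearMap.ext fun x => eq_of_forall_betheDual_eq fun sig => ?_)
    rw [spectrumEval_spec, spectrumEval_spec, hfg]
  · have h : LinearMap.range (spectrumEval N k).toLinearMap = ⊤ := by
      rw [eq_top_iff, ← span_schurValue, Submodule.span_le]
      rintro _ ⟨lam, rfl⟩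
      exact ⟨placticSchurGen lam, funext fun sig => spectrumEval_placticSchurGen lam sig⟩
    exact LinearMap.range_eq_top.1 h

/-- The algebra of affine plactic Schur polynomials is the coordinate ring of the Bethe variety. -/
def placticSchurAlgebraEquiv (N k : ℕ) :
    placticSchurAlgebra N k ≃ₐ[ℂ] (MvPolynomial (Fin k) ℂ ⧸ betheIdeal (N + 1) k) :=
  (AlgEquiv.ofBijective _ (spectrumEval_bijective N k)).trans
    ((Ideal.quotientEquivAlgOfEq ℂ (ker_betheEval N k).symm).trans
      (Ideal.quotientKerAlgEquivOfSurjective (betheEval_surjective N k))).symm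

theorem placticSchurAlgebraEquiv_gen (lam : BoxPartition N k) :
    placticSchurAlgebraEquiv N k (placticSchurGen lam) =
      Ideal.Quotient.mk (betheIdeal (N + 1) k) (schurE lam) := by
  rw [placticSchurAlgebraEquiv, AlgEquiv.trans_apply, AlgEquiv.symm_apply_eq]
  ext sig
  refine (spectrumEval_placticSchurGen lam sig).trans ?_
  exact (betheEval_schurE lam sig).symm

/-! ### The dual Jacobi-Trudi formula for semistandard tableaux -/

section Tableaux

variable {A : Type*} [CommRing A] (x : ℕ → A)

/-- The elementary symmetric function `e_r(x₀, ..., x_{l-1})` with integer index. -/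
def elemSymm (l : ℕ) (r : ℤ) : A :=
  if 0 ≤ r then
    (∏ i ∈ Finset.range l, (1 + Polynomial.C (x i) * Polynomial.X)).coeff r.toNat
  else 0

theorem elemSymm_of_neg (l : ℕ) {r : ℤ} (h : r < 0) : elemSymm x l r = 0 := if_neg (not_le.2 h)

theorem elemSymm_natCast (l r : ℕ) : elemSymm x l r =
    (∏ i ∈ Finset.range l, (1 + Polynomial.C (x i) * Polynomial.X)).coeff r := by
  simp [elemSymm]

theorem elemSymm_zero_left (r : ℤ) : elemSymm x 0 r = if r = 0 then 1 else 0 := by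
  rcases lt_or_ge r 0 with h | h
  · rw [elemSymm_of_neg x 0 h, if_neg h.ne]
  · lift r to ℕ using h
    rw [elemSymm_natCast, Finset.prod_range_zero, Polynomial.coeff_one]
    simp

theorem elemSymm_succ (l : ℕ) (r : ℤ) :
    elemSymm x (l + 1) r = x l * elemSymm x l (r - 1) + elemSymm x l r := by
  rcases lt_or_ge r 0 with h | h
  · rw [elemSymm_of_neg x _ h, elemSymm_of_neg x _ h, elemSymm_of_neg x _ (by omega)]
    ring
  · lift r to ℕ using h
    rw [elemSymm_natCast, elemSymm_natCast, Finset.prod_range_succ, mul_add, mul_one,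
      Polynomial.coeff_add, add_comm, mul_left_comm, Polynomial.coeff_C_mul]
    cases r with
    | zero =>
      rw [Polynomial.mul_coeff_zero, Polynomial.coeff_X_zero, elemSymm_of_neg x l (by simp)]
      ring
    | succ r =>
      rw [Polynomial.coeff_mul_X, ← elemSymm_natCast]
      congr 3
      push_cast
      ring

/-- The dual Jacobi-Trudi determinant `det (e_{μ_i - i + j})`. -/
def dualJacobiTrudi {M : ℕ} (l : ℕ) (μ : Fin M → ℤ) : A :=
  (Matrix.of fun i j : Fin M => elemSymm x l (μ i - ((i : ℕ) : ℤ) + ((j : ℕ) : ℤ))).det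

/-- Remove one box from every row in `S`. -/
def removeStrip {M : ℕ} (μ : Fin M → ℤ) (S : Finset (Fin M)) (i : Fin M) : ℤ :=
  μ i - if i ∈ S then 1 else 0

/-- By the recursion for e_r each row splits into two; expanding by multilinearity, S collects the
rows where the new variable is used and the index drops by one. -/
theorem dualJacobiTrudi_succ {M : ℕ} (l : ℕ) (μ : Fin M → ℤ) :
    dualJacobiTrudi x (l + 1) μ =
      ∑ S : Finset (Fin M), x l ^ S.card * dualJacobiTrudi x l (removeStrip μ S) := by
  have h := MultilinearMap.map_add_univ
    (Matrix.detRowAlternating (n := Fin M) (R := A)).toMultilinearMap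
    (fun i j => x l * elemSymm x l (μ i - ((i : ℕ) : ℤ) + ((j : ℕ) : ℤ) - 1))
    (fun i j => elemSymm x l (μ i - ((i : ℕ) : ℤ) + ((j : ℕ) : ℤ)))
  have h1 : dualJacobiTrudi x (l + 1) μ = (Matrix.detRowAlternating (n := Fin M)
      (R := A)).toMultilinearMap
      ((fun i (j : Fin M) => x l * elemSymm x l (μ i - ((i : ℕ) : ℤ) + ((j : ℕ) : ℤ) - 1)) +
        (fun i (j : Fin M) => elemSymm x l (μ i - ((i : ℕ) : ℤ) + ((j : ℕ) : ℤ)))) := by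
    rw [dualJacobiTrudi]
    simp only [elemSymm_succ]
    rfl
  rw [h1, h]
  refine Finset.sum_congr rfl fun S _ => ?_
  have h2 := Matrix.det_mul_column (fun i => if i ∈ S then x l else 1)
    (Matrix.of fun i j : Fin M =>
      elemSymm x l (removeStrip μ S i - ((i : ℕ) : ℤ) + ((j : ℕ) : ℤ)))
  rw [Finset.prod_ite_mem, Finset.univ_inter, Finset.prod_const] at h2
  rw [dualJacobiTrudi, ← h2]
  change Matrix.det _ = _
  congr 1
  ext i j
  rw [Matrix.of_apply, Matrix.of_apply]
  by_cases hi : i ∈ S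
  · rw [Finset.piecewise_eq_of_mem _ _ _ hi, if_pos hi, removeStrip, if_pos hi]
    congr 2
    ring
  · rw [Finset.piecewise_eq_of_notMem _ _ _ hi, if_neg hi, removeStrip, if_neg hi, one_mul,
      sub_zero]

/-- If monotonicity fails, two adjacent rows of the determinant coincide; if only positivity fails,
the last part is negative and the last row is zero. -/
theorem dualJacobiTrudi_removeStrip_eq_zero {M : ℕ} (l : ℕ) (μ : Fin M → ℤ) (hμ : Antitone μ)
    (S : Finset (Fin M)) (hS : ¬(Antitone (removeStrip μ S) ∧ ∀ i, 0 ≤ removeStrip μ S i)) :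
    dualJacobiTrudi x l (removeStrip μ S) = 0 := by
  cases M with
  | zero => exact absurd ⟨fun i => i.elim0, fun i => i.elim0⟩ hS
  | succ M =>
    by_cases ha : Antitone (removeStrip μ S)
    · have hneg : removeStrip μ S (Fin.last M) < 0 := by
        by_contra! h0
        exact hS ⟨ha, fun i => h0.trans (ha (Fin.le_last i))⟩
      refine Matrix.det_eq_zero_of_row_eq_zero (Fin.last M) fun j => ?_
      have := j.2
      rw [Matrix.of_apply]
      refine elemSymm_of_neg x l ?_
      rw [Fin.val_last]
      omega
    · rw [Fin.antitone_iff_succ_le] at ha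
      push Not at ha
      obtain ⟨i, hi⟩ := ha
      refine Matrix.det_zero_of_row_eq (Fin.castSucc_lt_succ (i := i)).ne (funext fun j => ?_)
      have h1 := hμ (Fin.castSucc_lt_succ (i := i)).le
      -- At most one box is removed from each part, so starting from an antitone μ the order can be
      -- violated by exactly one.
      have h2 : removeStrip μ S i.succ = removeStrip μ S i.castSucc + 1 := by
        unfold removeStrip at hi ⊢
        split_ifs at hi ⊢ <;> omega
      simp only [Matrix.of_apply, h2, Fin.val_castSucc, Fin.val_succ]
      congr 1
      push_cast
      ring

open scoped Classical in
/-- The weighted sum over all semistandard tableaux of shape `mu` with `l` letters. -/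
def tableauSum (l : ℕ) (mu : YoungDiagram) : A :=
  ∑ T : mu.cells → Fin l with IsSemistandard mu T, ∏ c, x (T c)

open scoped Classical in
/-- Semistandard tableaux whose largest letter fills a given horizontal strip. -/
theorem sum_tableaux_strip (l : ℕ) (mu nu : YoungDiagram) (hle : nu ≤ mu)
    (hstrip : ∀ c ∈ mu.cells, ∀ d ∈ mu.cells, c.2 = d.2 → c.1 < d.1 → c ∈ nu.cells) :
    ∑ T : mu.cells → Fin (l + 1) with IsSemistandard mu T ∧
        ∀ c : mu.cells, c.1 ∈ nu.cells ↔ T c ≠ Fin.last l, ∏ c, x (T c) =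
      x l ^ (mu.cells \ nu.cells).card * tableauSum x l nu := by
  have hsub : nu.cells ⊆ mu.cells := hle
  rw [tableauSum, Finset.mul_sum]
  symm
  set ext : (nu.cells → Fin l) → (mu.cells → Fin (l + 1)) := fun T c =>
    if h : c.1 ∈ nu.cells then (T ⟨c.1, h⟩).castSucc else Fin.last l with hext
  have hin : ∀ T (c : mu.cells) (h : c.1 ∈ nu.cells), ext T c = (T ⟨c.1, h⟩).castSucc :=
    fun T c h => dif_pos h
  have hout : ∀ T (c : mu.cells), c.1 ∉ nu.cells → ext T c = Fin.last l := fun T c h => dif_neg h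
  have hsemi : ∀ T, IsSemistandard mu (ext T) ↔ IsSemistandard nu T := by
    intro T
    constructor
    · rintro ⟨h1, h2⟩
      refine ⟨fun c d hcd hlt => ?_, fun c d hcd hlt => ?_⟩
      · have h := h1 ⟨c.1, hsub c.2⟩ ⟨d.1, hsub d.2⟩ hcd hlt
        rw [hin T _ c.2, hin T _ d.2] at h
        exact Fin.castSucc_le_castSucc_iff.1 h
      · have h := h2 ⟨c.1, hsub c.2⟩ ⟨d.1, hsub d.2⟩ hcd hlt
        rw [hin T _ c.2, hin T _ d.2] at h
        exact Fin.castSucc_lt_castSucc_iff.1 h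
    · rintro ⟨h1, h2⟩
      refine ⟨fun c d hcd hlt => ?_, fun c d hcd hlt => ?_⟩
      · by_cases hd : d.1 ∈ nu.cells
        · have hc : c.1 ∈ nu.cells :=
            nu.isLowerSet (show c.1 ≤ d.1 from ⟨hcd.le, hlt.le⟩) hd
          rw [hin T c hc, hin T d hd]
          exact Fin.castSucc_le_castSucc_iff.2 (h1 ⟨c.1, hc⟩ ⟨d.1, hd⟩ hcd hlt)
        · rw [hout T d hd]
          exact Fin.le_last _
      · have hc : c.1 ∈ nu.cells := hstrip c.1 c.2 d.1 d.2 hcd hlt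
        rw [hin T c hc]
        by_cases hd : d.1 ∈ nu.cells
        · rw [hin T d hd]
          exact Fin.castSucc_lt_castSucc_iff.2 (h2 ⟨c.1, hc⟩ ⟨d.1, hd⟩ hcd hlt)
        · rw [hout T d hd]
          exact Fin.castSucc_lt_last _
  refine Finset.sum_bij (fun T _ => ext T) (fun T hT => ?_) (fun T _ T' _ h => ?_)
    (fun T hT => ?_) (fun T _ => ?_)
  · refine Finset.mem_filter.2 ⟨Finset.mem_univ _, (hsemi T).2 (Finset.mem_filter.1 hT).2,
      fun c => ⟨fun h => ?_, fun h => ?_⟩⟩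
    · rw [hin T c h]
      exact (Fin.castSucc_lt_last _).ne
    · by_contra hc
      exact h (hout T c hc)
  · funext c
    have h1 := congrFun h ⟨c.1, hsub c.2⟩
    rw [hin T _ c.2, hin T' _ c.2] at h1
    exact Fin.castSucc_injective _ h1
  · obtain ⟨-, hT1, hT2⟩ := Finset.mem_filter.1 hT
    obtain ⟨T', hT'⟩ : ∃ T' : nu.cells → Fin l, ∀ c, (T' c).castSucc = T ⟨c.1, hsub c.2⟩ :=
      ⟨fun c => (T ⟨c.1, hsub c.2⟩).castPred ((hT2 _).1 c.2), fun c => Fin.castSucc_castPred _ _⟩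
    have he : ext T' = T := by
      funext c
      by_cases hc : c.1 ∈ nu.cells
      · rw [hin T' c hc, hT']
      · rw [hout T' c hc]
        by_contra hne
        exact hc ((hT2 c).2 (Ne.symm hne))
    exact ⟨T', Finset.mem_filter.2 ⟨Finset.mem_univ _, (hsemi T').1 (he ▸ hT1)⟩, he⟩
  · set y : ℕ × ℕ → A := fun c => if h : c ∈ nu.cells then x (T ⟨c, h⟩) else x l with hy
    have h1 : ∏ c, x (ext T c) = ∏ c ∈ mu.cells, y c := by
      rw [← Finset.prod_coe_sort mu.cells y]
      refine Finset.prod_congr rfl fun c _ => ?_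
      by_cases hc : c.1 ∈ nu.cells
      · rw [hin T c hc, hy]
        simp only [hc, dif_pos, Fin.val_castSucc]
      · rw [hout T c hc, hy]
        simp only [hc, dif_neg, not_false_eq_true, Fin.val_last]
    have h2 : ∏ c, x (T c) = ∏ c ∈ nu.cells, y c := by
      rw [← Finset.prod_coe_sort nu.cells y]
      refine Finset.prod_congr rfl fun c _ => ?_
      simp only [hy, c.2, dif_pos]
    have h3 : ∏ c ∈ mu.cells \ nu.cells, y c = x l ^ (mu.cells \ nu.cells).card := by
      rw [← Finset.prod_const]
      refine Finset.prod_congr rfl fun c hc => ?_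
      simp only [hy, (Finset.mem_sdiff.1 hc).2, dif_neg, not_false_eq_true]
    rw [h1, h2, ← h3, Finset.prod_sdiff hsub]

/-- The Young diagram with column lengths `lam`. -/
def columnDiagram {M : ℕ} (lam : Fin M → ℕ) (h : Antitone lam) : YoungDiagram where
  cells := (Finset.univ : Finset (Fin M)).biUnion fun i =>
    (Finset.range (lam i)).image fun j => (j, (i : ℕ))
  isLowerSet := by
    rintro ⟨j, i⟩ ⟨j', i'⟩ ⟨hj, hi⟩ hmem
    simp only [Finset.coe_biUnion, Finset.coe_univ, Set.mem_univ, Set.iUnion_true, Set.mem_iUnion,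
      Finset.mem_coe, Finset.mem_image, Finset.mem_range, Prod.mk.injEq] at hj hi hmem ⊢
    obtain ⟨a, b, hb, rfl, rfl⟩ := hmem
    have ha : i' < M := lt_of_le_of_lt hi a.2
    exact ⟨⟨i', ha⟩, j', lt_of_le_of_lt hj (hb.trans_le (h (show (⟨i', ha⟩ : Fin M) ≤ a from hi))),
      rfl, rfl⟩

theorem mem_columnDiagram {M : ℕ} {lam : Fin M → ℕ} {h : Antitone lam} {c : ℕ × ℕ} :
    c ∈ (columnDiagram lam h).cells ↔ ∃ i : Fin M, c.2 = i ∧ c.1 < lam i := by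
  obtain ⟨a, b⟩ := c
  simp only [columnDiagram, Finset.mem_biUnion, Finset.mem_univ, true_and, Finset.mem_image,
    Finset.mem_range, Prod.mk.injEq]
  constructor
  · rintro ⟨i, j, hj, rfl, rfl⟩
    exact ⟨i, rfl, hj⟩
  · rintro ⟨i, rfl, hj⟩
    exact ⟨i, a, hj, rfl, rfl⟩

theorem mk_mem_columnDiagram {M : ℕ} {lam : Fin M → ℕ} {h : Antitone lam} {j : ℕ} {i : Fin M} :
    (j, (i : ℕ)) ∈ (columnDiagram lam h).cells ↔ j < lam i := by
  rw [mem_columnDiagram]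
  constructor
  · rintro ⟨i', h1, h2⟩
    rwa [Fin.ext h1]
  · exact fun h => ⟨i, rfl, h⟩

open scoped Classical in
/-- The columns of a tableau containing the largest letter. -/
def lastColumns {M l : ℕ} {mu : YoungDiagram} (T : mu.cells → Fin (l + 1)) : Finset (Fin M) :=
  Finset.univ.filter fun i => ∃ c : mu.cells, c.1.2 = i ∧ T c = Fin.last l

theorem mem_lastColumns {M l : ℕ} {mu : YoungDiagram} (T : mu.cells → Fin (l + 1)) (i : Fin M) :
    i ∈ lastColumns T ↔ ∃ c : mu.cells, c.1.2 = i ∧ T c = Fin.last l := by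
  simp [lastColumns]

/-- Strictness down columns allows the largest letter only in the bottom cell of a column. -/
theorem eq_last_iff {M l : ℕ} {lam : Fin M → ℕ} {h : Antitone lam}
    {T : (columnDiagram lam h).cells → Fin (l + 1)} (hT : IsSemistandard _ T)
    (c : (columnDiagram lam h).cells) (i : Fin M) (hc : c.1.2 = i) :
    T c = Fin.last l ↔ i ∈ (lastColumns T : Finset (Fin M)) ∧ c.1.1 + 1 = lam i := by
  have key : ∀ d : (columnDiagram lam h).cells, d.1.2 = i → T d = Fin.last l →
      d.1.1 + 1 = lam i := by
    intro d hd hl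
    obtain ⟨⟨a, b⟩, hmem⟩ := d
    simp only at hd
    subst hd
    have hlt := mk_mem_columnDiagram.1 hmem
    by_contra hne
    simp only at hne
    have hmem' : (a + 1, (i : ℕ)) ∈ (columnDiagram lam h).cells :=
      mk_mem_columnDiagram.2 (by omega)
    have := hT.2 ⟨(a, (i : ℕ)), hmem⟩ ⟨(a + 1, (i : ℕ)), hmem'⟩ rfl (Nat.lt_succ_self a)
    rw [hl] at this
    exact absurd this (not_lt.2 (Fin.le_last _))
  constructor
  · exact fun hl => ⟨(mem_lastColumns T i).2 ⟨c, hc, hl⟩, key c hc hl⟩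
  · rintro ⟨hi, hci⟩
    obtain ⟨d, hd, hl⟩ := (mem_lastColumns T i).1 hi
    have : c = d := by
      refine Subtype.ext (Prod.ext ?_ (hc.trans hd.symm))
      have := key d hd hl
      omega
    rw [this, hl]

/-- The critical case is two columns of equal length: if the left one ends in the largest letter,
weak increase along the bottom row forces the right one to do so as well. -/
theorem antitone_removeStrip_lastColumns {M l : ℕ} {lam : Fin M → ℕ} {h : Antitone lam}
    {T : (columnDiagram lam h).cells → Fin (l + 1)} (hT : IsSemistandard _ T) :
    Antitone (removeStrip (fun i => (lam i : ℤ)) (lastColumns T)) ∧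
      ∀ i, 0 ≤ removeStrip (fun i => (lam i : ℤ)) (lastColumns T) i := by
  have hpos : ∀ i ∈ (lastColumns T : Finset (Fin M)), 1 ≤ lam i := by
    intro i hi
    obtain ⟨c, hc, hl⟩ := (mem_lastColumns T i).1 hi
    have := ((eq_last_iff hT c i hc).1 hl).2
    omega
  constructor
  · intro i j hij
    have h1 := h hij
    unfold removeStrip
    by_cases hi : i ∈ (lastColumns T : Finset (Fin M))
    · by_cases hj : j ∈ (lastColumns T : Finset (Fin M))
      · simp only [hi, hj, if_true]; omega
      · simp only [hi, hj, if_true, if_false]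
        rcases h1.lt_or_eq with h2 | h2
        · omega
        · exfalso
          have h3 := hpos i hi
          have hlt : i < j := lt_of_le_of_ne hij fun e => hj (e ▸ hi)
          have hci : (lam i - 1, (i : ℕ)) ∈ (columnDiagram lam h).cells :=
            mk_mem_columnDiagram.2 (by omega)
          have hcj : (lam i - 1, (j : ℕ)) ∈ (columnDiagram lam h).cells :=
            mk_mem_columnDiagram.2 (by omega)
          have h4 := (eq_last_iff hT ⟨_, hci⟩ i rfl).2 ⟨hi, by simp only; omega⟩
          have h5 := hT.1 ⟨_, hci⟩ ⟨_, hcj⟩ rfl hlt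
          rw [h4] at h5
          exact hj ((mem_lastColumns T j).2 ⟨⟨_, hcj⟩, rfl, le_antisymm (Fin.le_last _) h5⟩)
    · simp only [hi, if_false]
      split_ifs <;> omega
  · intro i
    simp only [removeStrip]
    split_ifs with hi
    · have := hpos i hi; omega
    · omega

theorem tableauSum_zero {M : ℕ} (lam : Fin M → ℕ) (h : Antitone lam) :
    tableauSum x 0 (columnDiagram lam h) = dualJacobiTrudi x 0 fun i => (lam i : ℤ) := by
  classical
  by_cases h0 : ∀ i, lam i = 0
  · have hemp : IsEmpty (columnDiagram lam h).cells := by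
      refine ⟨fun c => ?_⟩
      obtain ⟨i, -, hi⟩ := mem_columnDiagram.1 c.2
      rw [h0 i] at hi
      exact absurd hi (Nat.not_lt_zero _)
    have h1 : dualJacobiTrudi x 0 (fun i => (lam i : ℤ)) = 1 := by
      rw [dualJacobiTrudi, Matrix.det_of_isUpperTriangular]
      · refine Finset.prod_eq_one fun i _ => ?_
        simp [elemSymm_zero_left, h0]
      · intro i j hij
        have hij : j < i := hij
        rw [Fin.lt_def] at hij
        rw [Matrix.of_apply, h0]
        exact elemSymm_of_neg x 0 (by push_cast; omega)
    rw [h1, tableauSum, Finset.filter_true_of_mem]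
    · simp
    · exact fun T _ => ⟨fun c => hemp.elim c, fun c => hemp.elim c⟩
  · push Not at h0
    obtain ⟨i, hi⟩ := h0
    have hM : 0 < M := i.pos
    -- With no letters a nonempty shape has no filling, and the first row of the determinant has
    -- only positive indices, where e_r of no variables vanishes.
    have h1 : lam ⟨0, hM⟩ ≠ 0 := by
      have := h (show (⟨0, hM⟩ : Fin M) ≤ i from Nat.zero_le _)
      omega
    rw [dualJacobiTrudi, Matrix.det_eq_zero_of_row_eq_zero ⟨0, hM⟩, tableauSum]
    · have hE : IsEmpty ((columnDiagram lam h).cells → Fin 0) :=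
        ⟨fun T => (T ⟨(0, ((⟨0, hM⟩ : Fin M) : ℕ)),
          mk_mem_columnDiagram.2 (Nat.pos_of_ne_zero h1)⟩).elim0⟩
      exact Finset.sum_eq_zero fun T _ => hE.elim T
    · intro j
      rw [Matrix.of_apply, elemSymm_zero_left, if_neg]
      simp only
      omega

/-- The dual Jacobi-Trudi formula: the sum over semistandard tableaux with column lengths `lam` is
the determinant of the elementary symmetric functions `e_{lam_i - i + j}`. -/
theorem tableauSum_eq_dualJacobiTrudi {M : ℕ} (l : ℕ) (lam : Fin M → ℕ) (h : Antitone lam) :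
    tableauSum x l (columnDiagram lam h) = dualJacobiTrudi x l fun i => (lam i : ℤ) := by
  classical
  induction l generalizing lam with
  | zero => exact tableauSum_zero x lam h
  | succ l ih =>
    -- Tableaux are grouped by the set S of columns containing the largest letter, to be matched
    -- term by term with the expansion of the determinant over sets of rows.
    rw [dualJacobiTrudi_succ, tableauSum, ← Finset.sum_fiberwise _ (fun T => lastColumns T)]
    refine Finset.sum_congr rfl fun S _ => ?_
    set μ := removeStrip (fun i => (lam i : ℤ)) S with hμ
    by_cases hS : Antitone μ ∧ ∀ i, 0 ≤ μ i
    swap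
    · rw [dualJacobiTrudi_removeStrip_eq_zero x l _ (fun i j hij => by exact_mod_cast h hij) S hS,
        mul_zero, Finset.filter_false_of_mem, Finset.sum_empty]
      rintro T hT rfl
      exact hS (antitone_removeStrip_lastColumns (Finset.mem_filter.1 hT).2)
    obtain ⟨hanti, hpos⟩ := hS
    have hanti' : Antitone fun i => (μ i).toNat := fun i j hij => Int.toNat_le_toNat (hanti hij)
    have hcast : μ = fun i => (((μ i).toNat : ℕ) : ℤ) :=
      funext fun i => (Int.toNat_of_nonneg (hpos i)).symm
    have hin : ∀ i ∈ S, (μ i).toNat + 1 = lam i := by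
      intro i hi
      have h1 := hpos i
      simp only [hμ, removeStrip, hi, if_true] at h1 ⊢
      omega
    have hout : ∀ i ∉ S, (μ i).toNat = lam i := by
      intro i hi
      simp only [hμ, removeStrip, hi, if_false]
      omega
    set nu := columnDiagram _ hanti' with hnu
    have hle : nu ≤ columnDiagram lam h := by
      intro c hc
      obtain ⟨i, hi, hlt⟩ := mem_columnDiagram.1 hc
      refine mem_columnDiagram.2 ⟨i, hi, ?_⟩
      by_cases hiS : i ∈ S
      · have := hin i hiS; omega
      · have := hout i hiS; omega
    have hstrip : ∀ c ∈ (columnDiagram lam h).cells, ∀ d ∈ (columnDiagram lam h).cells,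
        c.2 = d.2 → c.1 < d.1 → c ∈ nu.cells := by
      intro c _ d hd hcd hlt
      obtain ⟨i, hi, hdi⟩ := mem_columnDiagram.1 hd
      refine mem_columnDiagram.2 ⟨i, hcd.trans hi, ?_⟩
      by_cases hiS : i ∈ S
      · have := hin i hiS; omega
      · have := hout i hiS; omega
    have hcard : ((columnDiagram lam h).cells \ nu.cells).card = S.card := by
      symm
      refine Finset.card_bij (fun i _ => ((μ i).toNat, (i : ℕ))) (fun i hi => ?_)
        (fun i _ j _ hij => Fin.ext (Prod.ext_iff.1 hij).2) (fun c hc => ?_)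
      · have := hin i hi
        rw [Finset.mem_sdiff, mk_mem_columnDiagram, mk_mem_columnDiagram]
        omega
      · obtain ⟨h1, h2⟩ := Finset.mem_sdiff.1 hc
        obtain ⟨a, b⟩ := c
        obtain ⟨i, hi, hlt⟩ := mem_columnDiagram.1 h1
        simp only at hi hlt
        subst hi
        rw [mk_mem_columnDiagram] at h2
        by_cases hiS : i ∈ S
        · refine ⟨i, hiS, ?_⟩
          have := hin i hiS
          rw [Prod.mk.injEq]
          exact ⟨by omega, rfl⟩
        · have := hout i hiS; omega
    have hfil : ∀ T : (columnDiagram lam h).cells → Fin (l + 1), IsSemistandard _ T →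
        (lastColumns T = S ↔ ∀ c : (columnDiagram lam h).cells, c.1 ∈ nu.cells ↔
          T c ≠ Fin.last l) := by
      intro T hT
      constructor
      · rintro rfl c
        obtain ⟨i, hi, hlt⟩ := mem_columnDiagram.1 c.2
        rw [Ne, eq_last_iff hT c i hi]
        have hmem : c.1 ∈ nu.cells ↔ c.1.1 < (μ i).toNat := by
          rw [← mk_mem_columnDiagram (h := hanti'), ← hi]
        rw [hmem]
        by_cases hiS : i ∈ (lastColumns T : Finset (Fin M))
        · have := hin i hiS
          simp only [hiS, true_and]
          omega
        · have := hout i hiS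
          simp only [hiS, false_and, not_false_eq_true, iff_true]
          omega
      · intro hc
        ext i
        rw [mem_lastColumns]
        constructor
        · rintro ⟨c, hci, hl⟩
          by_contra hiS
          refine (hc c).1 ?_ hl
          obtain ⟨i', hi', hlt⟩ := mem_columnDiagram.1 c.2
          obtain rfl : i = i' := Fin.ext (hci.symm.trans hi')
          exact mem_columnDiagram.2 ⟨i, hci, by rw [hout i hiS]; exact hlt⟩
        · intro hiS
          have h1 := hin i hiS
          have hmem : ((μ i).toNat, (i : ℕ)) ∈ (columnDiagram lam h).cells :=
            mk_mem_columnDiagram.2 (by omega)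
          refine ⟨⟨_, hmem⟩, rfl, ?_⟩
          by_contra hne
          have := mk_mem_columnDiagram.1 ((hc ⟨_, hmem⟩).2 hne)
          exact lt_irrefl _ this
    rw [Finset.filter_filter, hcast, ← ih _ hanti', ← hcard, ← sum_tableaux_strip x l _ nu hle hstrip]
    refine Finset.sum_congr (Finset.filter_congr fun T _ => ?_) fun _ _ => rfl
    exact and_congr_right fun hT => hfil T hT

end Tableaux

/-! ### Identification of `schurE` with the Schur polynomial of the transposed diagram -/

theorem BoxPartition.antitone_val {N k : ℕ} (lam : BoxPartition N k) :
    Antitone fun i => (lam.1 i : ℕ) := fun _ _ hij => lam.2 hij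

theorem transpose_diagram {N k : ℕ} (lam : BoxPartition N k) :
    (diagram lam).transpose = columnDiagram (fun i => (lam.1 i : ℕ))
      (BoxPartition.antitone_val lam) := by
  ext c
  obtain ⟨a, b⟩ := c
  rw [YoungDiagram.mem_cells, YoungDiagram.mem_transpose, ← YoungDiagram.mem_cells,
    mem_columnDiagram]
  simp only [diagram, Prod.swap_prod_mk, Finset.mem_filter, Finset.mem_product, Finset.mem_range]
  constructor
  · rintro ⟨⟨h1, h2⟩, h3⟩
    exact ⟨⟨b, h1⟩, rfl, by simpa [part, h1] using h3⟩
  · rintro ⟨i, rfl, h⟩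
    have := (lam.1 i).2
    exact ⟨⟨i.2, by omega⟩, by simpa [part] using h⟩

/-- The variables of `ℂ[x₁, ..., x_k]` continued by zero. -/
def varOrZero (k i : ℕ) : MvPolynomial (Fin k) ℂ :=
  if h : i < k then MvPolynomial.X ⟨i, h⟩ else 0

theorem varOrZero_val {k : ℕ} (i : Fin k) : varOrZero k i = MvPolynomial.X i := by
  simp [varOrZero]

theorem esymm_eq_elemSymm (k r : ℕ) :
    MvPolynomial.esymm (Fin k) ℂ r = elemSymm (varOrZero k) k r := by
  rw [elemSymm_natCast, ← Fin.prod_univ_eq_prod_range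
    (fun i => (1 + Polynomial.C (varOrZero k i) * Polynomial.X)) k, Finset.prod_one_add,
    Polynomial.finsetSum_coeff, MvPolynomial.esymm, Finset.powersetCard_eq_filter,
    Finset.sum_filter]
  refine Finset.sum_congr rfl fun t _ => ?_
  rw [Finset.prod_mul_distrib, Finset.prod_const, ← map_prod, Polynomial.coeff_C_mul,
    Polynomial.coeff_X_pow]
  simp only [varOrZero_val, mul_ite, mul_one, mul_zero, eq_comm]

theorem esymmAlgHom_eVar (k : ℕ) (r : ℤ) :
    (MvPolynomial.esymmAlgHom (Fin k) ℂ k (eVar k r) : MvPolynomial (Fin k) ℂ) =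
      elemSymm (varOrZero k) k r := by
  rcases lt_or_ge r 0 with h0 | h0
  · rw [elemSymm_of_neg _ _ h0, eVar, if_neg h0.ne, dif_neg (by omega), map_zero]
    rfl
  · lift r to ℕ using h0
    rw [← esymm_eq_elemSymm]
    rcases Nat.eq_zero_or_pos r with rfl | hr
    · rw [eVar, Nat.cast_zero, if_pos rfl, map_one, MvPolynomial.esymm_zero]
      rfl
    · rw [eVar, if_neg (by omega)]
      split_ifs with h
      · rw [MvPolynomial.esymmAlgHom, MvPolynomial.aeval_X]
        simp only
        congr 1
        omega
      · rw [map_zero, MvPolynomial.esymm, Finset.powersetCard_eq_empty.2, Finset.sum_empty]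
        · rfl
        · simp; omega

theorem esymmAlgHom_schurE {N k : ℕ} (lam : BoxPartition N k) :
    (MvPolynomial.esymmAlgHom (Fin k) ℂ k (schurE lam) : MvPolynomial (Fin k) ℂ) =
      schurPoly k (diagram lam).transpose := by
  have h1 : schurPoly k (diagram lam).transpose =
      tableauSum (varOrZero k) k (diagram lam).transpose := by
    simp only [schurPoly, tableauSum, varOrZero_val]
  rw [h1, transpose_diagram, tableauSum_eq_dualJacobiTrudi, schurE, AlgHom.map_det,
    ← Subalgebra.coe_val, AlgHom.map_det, dualJacobiTrudi]
  congr 1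
  ext1 i j
  exact esymmAlgHom_eVar k _

end PhaseModel
end

open PhaseModel

/-- The identification of ℂ[e₁, ..., e_k] with symmetric polynomials enters through `p`: by
algebraic independence of the elementary symmetric polynomials it is the only element representing
the Schur polynomial. -/
theorem mainTheorem7 (N k : ℕ) :
    (∃ Φ : placticSchurAlgebra N k ≃ₐ[ℂ] (MvPolynomial (Fin k) ℂ ⧸ betheIdeal (N + 1) k),
      ∀ lam : BoxPartition N k, ∃ p : MvPolynomial (Fin k) ℂ,
        (MvPolynomial.esymmAlgHom (Fin k) ℂ k p : MvPolynomial (Fin k) ℂ) =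
            schurPoly k (diagram lam).transpose ∧
          Φ (placticSchurGen lam) = Ideal.Quotient.mk (betheIdeal (N + 1) k) p) ∧
    (∀ lam mu : BoxPartition N k,
      placticSchurLevel lam * placticSchurLevel mu =
        ∑ nu : BoxPartition N k, fusionCoeff lam mu nu • placticSchurLevel nu) ∧
    (∀ lam mu : BoxPartition N k,
      placticSchurLevel lam (weightVec mu) =
        ∑ nu : BoxPartition N k, fusionCoeff lam mu nu • weightVec nu) :=
  ⟨⟨placticSchurAlgebraEquiv N k, fun lam =>
    ⟨schurE lam, esymmAlgHom_schurE lam, placticSchurAlgebraEquiv_gen lam⟩⟩,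
    placticSchurLevel_mul, placticSchurLevel_weightVec⟩
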